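/- Let $0<H<1$ and let $B_H=(B_H(t))_{t\in\mathbb R}$ be a fractional Brownian motion with Hurst exponent $H$ (a centered Gaussian process with a.s. continuous paths and covariance $\tfrac{v}{2}\,(|s|^{2H}+|t|^{2H}-|s-t|^{2H})$, where $v=\operatorname{Var}B_H(1)$). Let $\psi:\mathbb R\to\mathbb R$ satisfy $\int(1+|t|^H)|\psi(t)|\,dt<\infty$ and $\int\psi=0$, and for $j,k\in\mathbb Z$ let $$d_{jk}=\int_{\mathbb R}B_H(t)\,2^{j/2}\psi(2^j(t-k))\,dt$$ be the nondecimated wavelet coefficients. Assume $\operatorname{Var}d_{00}>0$. Fix $m\ge 2$ consecutive levels $j=j_0,\dots,j_0+m-1$ and separation distances $q_j\in\mathbb R$ such that $d_{jk_1}$ and $d_{jk_2}$ are independent whenever $j$ is one of these levels and $|k_1-k_2|>q_j$. For each sample size $N$ and each of the $m$ levels $j$, let $N$ pairs of (possibly random) positions $(k_1,k_2)$ with $|k_1-k_2|>q_j$ a.s. be drawn, each pair of positions independent of the family of all coefficients. Assume that, for each $N$, the $mN$ sampled pairs of coefficients $(d_{jk_1},d_{jk_2})$ are mutually independent, within and across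 the levels. Let $\hat y_j^*$ be the sample median, over the $N$ pairs sampled at level $j$, of $\log\big[(d_{jk_1}^2+d_{jk_2}^2)/2\big]$, let $\hat\beta$ be the ordinary least squares slope of the regression of $\hat y_j^*$ on $j$ over the $m$ levels, and let $$\widehat H=-\frac{\hat\beta}{2\log 2}-\frac12$$ be the MEDLA estimator. Then $\widehat H$ is asymptotically normal with mean $H$ and variance $\dfrac{3}{N\,m(m^2-1)(\log 2)^4}$. Precisely, as $N\to\infty$ with everything else fixed, $$\sqrt N\,(\widehat H-H)\ \xrightarrow{\ d\ }\ \mathcal N\!\left(0,\ \frac{3}{m(m^2-1)(\log 2)^4}\right);$$ moreover $\widehat H$ is square integrable with $\mathbb E\,\widehat H=H$ for every $N\ge1$, and $$N\operatorname{Var}(\hat y_j^*)\to\frac1{(\log 2)^2}\ \text{ for each of the levels } j,\qquad N\operatorname{Var}(\hat\beta)\to\frac{12}{m(m^2-1)(\log 2)^2},\qquad N\operatorname{Var}(\widehat H)\to\frac{3}{m(m^2-1)(\log 2)^4}.$$ -/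

import Mathlib

open MeasureTheory ProbabilityTheory Filter Topology

noncomputable section

/-- Fractional Brownian motion on `ℝ` with Hurst exponent `H`, of arbitrary scale `Var (B 1)`:
a centered Gaussian process with almost surely continuous paths and covariance
`Var (B 1) / 2 * (|s| ^ (2 * H) + |t| ^ (2 * H) - |s - t| ^ (2 * H))`. -/
structure IsFractionalBrownianMotion {Ω : Type*} [MeasurableSpace Ω] (H : ℝ)
    (B : ℝ → Ω → ℝ) (μ : Measure Ω) : Prop where
  gaussian : IsGaussianProcess B μ
  centered : ∀ t, ∫ ω, B t ω ∂μ = 0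
  covariance : ∀ s t, ProbabilityTheory.covariance (B s) (B t) μ =
    ProbabilityTheory.variance (B 1) μ / 2 *
      (|s| ^ (2 * H) + |t| ^ (2 * H) - |s - t| ^ (2 * H))
  continuous_paths : ∀ᵐ ω ∂μ, Continuous fun t => B t ω

/-- The nondecimated wavelet atom `ψ_{jk}(t) = 2^{j/2} ψ(2^j (t - k))`. -/
def waveletAtom (ψ : ℝ → ℝ) (j k : ℤ) (t : ℝ) : ℝ :=
  (2 : ℝ) ^ ((j : ℝ) / 2) * ψ ((2 : ℝ) ^ j * (t - k))

/-- The nondecimated wavelet coefficient `d_{jk} = ∫ B(t) ψ_{jk}(t) dt` of the process `B`. -/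
def waveletCoeff {Ω : Type*} (B : ℝ → Ω → ℝ) (ψ : ℝ → ℝ) (j k : ℤ) (ω : Ω) : ℝ :=
  ∫ t, B t ω * waveletAtom ψ j k t

/-- The sample median of `N` real numbers: the middle order statistic, or the mean of the two
middle ones if `N` is even (and `0` for the empty sample). -/
def sampleMedian {N : ℕ} (x : Fin N → ℝ) : ℝ :=
  if h : 0 < N then
    (x (Tuple.sort x ⟨(N - 1) / 2, by omega⟩) + x (Tuple.sort x ⟨N / 2, by omega⟩)) / 2
  else 0

/-- The slope of the ordinary least squares regression line through the points `(x i, y i)`. -/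
def olsSlope {m : ℕ} (x y : Fin m → ℝ) : ℝ :=
  (∑ i, (x i - (∑ l, x l) / m) * (y i - (∑ l, y l) / m)) / ∑ i, (x i - (∑ l, x l) / m) ^ 2

/-- The two coefficients of a sampled pair: level `j`, (random) positions `k 0` and `k 1`. -/
def sampledPair {Ω : Type*} (B : ℝ → Ω → ℝ) (ψ : ℝ → ℝ) (j : ℤ) (k : Fin 2 → Ω → ℤ)
    (ω : Ω) : ℝ × ℝ :=
  (waveletCoeff B ψ j (k 0 ω) ω, waveletCoeff B ψ j (k 1 ω) ω)

/-- The logarithm of the average of the two energies of a pair of coefficients. -/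
def logMeanEnergy (d : ℝ × ℝ) : ℝ := Real.log ((d.1 ^ 2 + d.2 ^ 2) / 2)

/-- The sample median at level `j` of the log-averaged energies of `N` sampled pairs. -/
def medlaMedian {Ω : Type*} (B : ℝ → Ω → ℝ) (ψ : ℝ → ℝ) (j : ℤ) {N : ℕ}
    (k : Fin N → Fin 2 → Ω → ℤ) (ω : Ω) : ℝ :=
  sampleMedian fun i => logMeanEnergy (sampledPair B ψ j (k i) ω)

/-- The OLS slope in the regression of the level-wise sample medians on the `m` consecutive
levels `j₀, …, j₀ + m - 1`. -/
def medlaSlope {Ω : Type*} (B : ℝ → Ω → ℝ) (ψ : ℝ → ℝ) (j₀ : ℤ) {m N : ℕ}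
    (k : Fin m → Fin N → Fin 2 → Ω → ℤ) (ω : Ω) : ℝ :=
  olsSlope (fun l : Fin m => ((j₀ + (l : ℤ) : ℤ) : ℝ))
    fun l : Fin m => medlaMedian B ψ (j₀ + (l : ℤ)) (k l) ω

/-- The MEDLA estimator of the Hurst exponent. -/
def medlaEstimator {Ω : Type*} (B : ℝ → Ω → ℝ) (ψ : ℝ → ℝ) (j₀ : ℤ) {m N : ℕ}
    (k : Fin m → Fin N → Fin 2 → Ω → ℤ) (ω : Ω) : ℝ :=
  -medlaSlope B ψ j₀ k ω / (2 * Real.log 2) - 1 / 2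

end

/-!
A wavelet coefficient of fractional Brownian motion is centred Gaussian, and its law depends on the
level `j` only, with variance `2 ^ (-j * (2 * H + 1)) * Var d₀₀` (`hasLaw_waveletCoeff`): after
centring the path at the position `k`, which the vanishing integral of `ψ` permits, the rescaled
increments form a fractional Brownian motion again, and the law of an integral of a Gaussian process
is determined by the covariance (`exists_hasLaw_gaussianReal_integral`). Random positions that are
independent of the coefficients do not change this law (`hasLaw_sampledPair`).

A pair of independent `N(0, v)` variables has a mean energy which is `v` times a standard
exponential variable, by integration in polar coordinates. So the log-energy is `log v` plus a
variable of distribution function `1 - exp (-exp x)`, with median `log (log 2)` and density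
`log 2 / 2` at the median (`logEnergyLaw_real_Iic`, `map_logMeanEnergy_sub_eq`). Since the sample
median is translation equivariant, the level-wise medians are `log v_j`, which is affine in `j` with
slope `-(2 * H + 1) * log 2`, plus independent medians of `N` independent copies of one variable.
The least squares slope is a contrast, that is, a linear combination with weights of sum zero, so
the common centre of these medians drops out: the estimator is `H` plus a contrast of identically
distributed variables (`medlaEstimator_eq`), and hence exactly unbiased.

What remains is the asymptotics of one sample median, with convergence of the first two moments.
The event that the median is at most `t` is, up to ties, the event that at least half of the sample
is at most `t`. The central limit theorem for this count, at `t` within `O(1 / √N)` of the true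
median, gives the convergence of the distribution functions (`tendsto_medianLaw_real_Iic`).
Chernoff's bound for the same count and Bernoulli's inequality give tails `O(|t|⁻⁴)` that are
uniform in `N` (`abs_signedTail_medianLaw_le`). Writing expectations as integrals of tails and using
dominated convergence, the means, the second moments and the characteristic functions all converge
(`tendsto_integral_medianLaw`). Independence of the levels and `∑ (x_l - x̄) ^ 2 = m (m² - 1) / 12`
then give the variances and the Gaussian limit.
-/

/-! ### Order statistics and the sample median -/

/-- The `k`-th order statistic is at most `t` exactly when more than `k` observations are. -/
lemma apply_sort_le_iff {N : ℕ} (x : Fin N → ℝ) (k : Fin N) (t : ℝ) :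
    x (Tuple.sort x k) ≤ t ↔ (k : ℕ) < (Finset.univ.filter fun i => x i ≤ t).card := by
  have h := Tuple.lt_card_le_iff_apply_le_of_monotone (j := k) (a := t) (Tuple.monotone_sort x)
  rw [show x (Tuple.sort x k) = (x ∘ Tuple.sort x) k from rfl, ← h]
  have hc : (Finset.univ.filter fun i => (x ∘ Tuple.sort x) i ≤ t).card =
      (Finset.univ.filter fun i => x i ≤ t).card := by
    refine Finset.card_equiv (Tuple.sort x) fun i => ?_
    simp
  rw [hc]

lemma measurable_apply_sort {N : ℕ} (k : Fin N) :
    Measurable fun x : Fin N → ℝ => x (Tuple.sort x k) := by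
  refine measurable_of_Iic fun t => ?_
  have : (fun x : Fin N → ℝ => x (Tuple.sort x k)) ⁻¹' Set.Iic t =
      {x | (k : ℕ) < ∑ i, if x i ≤ t then 1 else 0} := by
    ext x
    simp only [Set.mem_preimage, Set.mem_Iic, apply_sort_le_iff, Set.mem_ofPred_eq,
      Finset.card_filter]
  rw [this]
  refine measurableSet_lt measurable_const (Finset.measurable_fun_sum _ fun i _ => ?_)
  exact Measurable.ite (measurableSet_le (measurable_pi_apply i) measurable_const)
    measurable_const measurable_const

lemma measurable_sampleMedian {N : ℕ} : Measurable (sampleMedian : (Fin N → ℝ) → ℝ) := by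
  unfold sampleMedian
  by_cases h : 0 < N
  · simp only [h, dite_true]
    exact ((measurable_apply_sort _).add (measurable_apply_sort _)).div_const 2
  · simp only [h, dite_false]
    exact measurable_const

lemma apply_sort_add_const {N : ℕ} (x : Fin N → ℝ) (c : ℝ) (k : Fin N) :
    x (Tuple.sort (fun i => x i + c) k) + c = x (Tuple.sort x k) + c := by
  refine eq_of_forall_ge_iff fun t => ?_
  have h := apply_sort_le_iff (fun i => x i + c) k t
  simp only [← le_sub_iff_add_le] at h ⊢
  rw [h, apply_sort_le_iff x]

/-- The sample median is equivariant under translations of a nonempty sample. -/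
lemma sampleMedian_add_const {N : ℕ} (hN : 0 < N) (x : Fin N → ℝ) (c : ℝ) :
    sampleMedian (fun i => x i + c) = sampleMedian x + c := by
  have h := apply_sort_add_const x c
  simp only [sampleMedian, hN, dite_true, h]
  ring

lemma abs_sampleMedian_le {N : ℕ} (x : Fin N → ℝ) : |sampleMedian x| ≤ ∑ i, |x i| := by
  unfold sampleMedian
  split_ifs with h
  · have hs (k : Fin N) : |x k| ≤ ∑ i, |x i| :=
      Finset.single_le_sum (f := fun i => |x i|) (fun i _ => abs_nonneg _) (Finset.mem_univ k)
    have h1 := abs_le.1 (hs (Tuple.sort x ⟨(N - 1) / 2, by omega⟩))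
    have h2 := abs_le.1 (hs (Tuple.sort x ⟨N / 2, by omega⟩))
    exact abs_le.2 ⟨by linarith, by linarith⟩
  · simpa using Finset.sum_nonneg fun i _ => abs_nonneg (x i)

lemma apply_sort_lower_le_upper {N : ℕ} (hN : 0 < N) (x : Fin N → ℝ) :
    x (Tuple.sort x ⟨(N - 1) / 2, by omega⟩) ≤ x (Tuple.sort x ⟨N / 2, by omega⟩) :=
  Tuple.monotone_sort x (Fin.mk_le_mk.2 (by omega))

/-- If the median is at most `t`, then so is at least half of the sample. -/
lemma le_two_mul_card_of_sampleMedian_le {N : ℕ} (x : Fin N → ℝ) {t : ℝ}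
    (h : sampleMedian x ≤ t) : N ≤ 2 * (Finset.univ.filter fun i => x i ≤ t).card := by
  rcases Nat.eq_zero_or_pos N with rfl | hN
  · simp
  have h1 := apply_sort_lower_le_upper hN x
  simp only [sampleMedian, hN, dite_true] at h
  have h2 : x (Tuple.sort x ⟨(N - 1) / 2, by omega⟩) ≤ t := by linarith
  have h3 := (apply_sort_le_iff x _ t).1 h2
  simp only at h3
  omega

/-- If more than half of the sample is at most `t`, then so is the median. -/
lemma sampleMedian_le_of_lt_two_mul_card {N : ℕ} (x : Fin N → ℝ) {t : ℝ}
    (h : N < 2 * (Finset.univ.filter fun i => x i ≤ t).card) : sampleMedian x ≤ t := by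
  have hN : 0 < N := by
    rcases Nat.eq_zero_or_pos N with rfl | hN
    · simp at h
    · exact hN
  have h1 := apply_sort_lower_le_upper hN x
  have h2 : x (Tuple.sort x ⟨N / 2, by omega⟩) ≤ t :=
    (apply_sort_le_iff x _ t).2 (by simp only; omega)
  simp only [sampleMedian, hN, dite_true]
  linarith

/-! ### Expectations as integrals of distribution tails -/

/-- The tail of a law on the line at `t`, taken on the side of `t` away from the origin, with the
sign of that side. -/
noncomputable def signedTail (ν : Measure ℝ) (t : ℝ) : ℝ :=
  if 0 < t then ν.real (Set.Ioi t) else -ν.real (Set.Iic t)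

/-- The pointwise version of `signedTail`: the signed indicator that `z` lies beyond `t`. -/
noncomputable def signedBeyond (z t : ℝ) : ℝ :=
  if 0 < t then (if t < z then 1 else 0) else (if z ≤ t then -1 else 0)

lemma measurable_signedBeyond : Measurable fun p : ℝ × ℝ => signedBeyond p.1 p.2 := by
  unfold signedBeyond
  refine Measurable.ite (measurableSet_lt measurable_const measurable_snd) ?_ ?_
  · exact Measurable.ite (measurableSet_lt measurable_snd measurable_fst) measurable_const
      measurable_const
  · exact Measurable.ite (measurableSet_le measurable_fst measurable_snd) measurable_const
      measurable_const

lemma abs_signedBeyond_le (z t : ℝ) : |signedBeyond z t| ≤ 1 := by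
  unfold signedBeyond
  split_ifs <;> simp

lemma integral_signedBeyond (ν : Measure ℝ) (t : ℝ) :
    ∫ z, signedBeyond z t ∂ν = signedTail ν t := by
  unfold signedBeyond signedTail
  split_ifs with h
  · have : (fun z : ℝ => if t < z then (1 : ℝ) else 0) = (Set.Ioi t).indicator 1 := by
      ext z; simp [Set.indicator_apply]
    rw [this, integral_indicator_one measurableSet_Ioi]
  · have : (fun z : ℝ => if z ≤ t then (-1 : ℝ) else 0) = fun z => -(Set.Iic t).indicator 1 z := by
      ext z; by_cases hz : z ≤ t <;> simp [hz]
    rw [this, integral_neg, integral_indicator_one measurableSet_Iic]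

lemma integral_abs_signedBeyond (ν : Measure ℝ) (t : ℝ) :
    ∫ z, |signedBeyond z t| ∂ν = |signedTail ν t| := by
  rw [← integral_signedBeyond]
  by_cases h : 0 < t
  · have h0 (z : ℝ) : 0 ≤ signedBeyond z t := by
      unfold signedBeyond; simp only [h, if_true]; split_ifs <;> simp
    simp_rw [fun z => abs_of_nonneg (h0 z)]
    rw [abs_of_nonneg (integral_nonneg h0)]
  · have h0 (z : ℝ) : signedBeyond z t ≤ 0 := by
      unfold signedBeyond; simp only [h, if_false]; split_ifs <;> simp
    simp_rw [fun z => abs_of_nonpos (h0 z)]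
    rw [abs_of_nonpos (integral_nonpos h0), integral_neg]

/-- The fundamental theorem of calculus, written with `signedBeyond`. -/
lemma integral_mul_signedBeyond {g g' : ℝ → ℝ} (hg : ∀ t, HasDerivAt g (g' t) t)
    (hg' : Continuous g') (z : ℝ) : ∫ t, g' t * signedBeyond z t = g z - g 0 := by
  rw [← intervalIntegral.integral_eq_sub_of_hasDerivAt (fun t _ => hg t)
    (hg'.intervalIntegrable _ _)]
  rcases le_or_gt z 0 with hz | hz
  · have : (fun t => g' t * signedBeyond z t) = (Set.Icc z 0).indicator fun t => -g' t := by
      ext t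
      unfold signedBeyond
      by_cases h1 : 0 < t
      · have : t ∉ Set.Icc z 0 := fun h => absurd h.2 (not_le.2 h1)
        simp [h1, this, not_lt.2 (hz.trans h1.le)]
      · by_cases h2 : z ≤ t
        · simp [h1, h2, not_lt.1 h1]
        · simp [h1, h2]
    rw [this, integral_indicator measurableSet_Icc, integral_neg, integral_Icc_eq_integral_Ioc,
      intervalIntegral.integral_of_ge hz]
  · have : (fun t => g' t * signedBeyond z t) = (Set.Ioo 0 z).indicator g' := by
      ext t
      unfold signedBeyond
      by_cases h1 : 0 < t
      · by_cases h2 : t < z <;> simp [h1, h2]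
      · have h2 : ¬ z ≤ t := fun h => h1 (hz.trans_le h)
        simp [h1, h2]
    rw [this, integral_indicator measurableSet_Ioo, ← integral_Ioc_eq_integral_Ioo,
      intervalIntegral.integral_of_le hz.le]

lemma integrable_one_add_abs_rpow_neg_three :
    Integrable fun t : ℝ => (1 + |t|) ^ (-3 : ℝ) :=
  integrable_one_add_norm (E := ℝ) (r := 3) (by simp)

lemma measurable_signedTail (ν : Measure ℝ) [IsFiniteMeasure ν] : Measurable (signedTail ν) := by
  refine Measurable.ite (measurableSet_lt measurable_const measurable_id) ?_ ?_
  · refine Antitone.measurable fun a b hab => ?_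
    exact measureReal_mono (Set.Ioi_subset_Ioi hab)
  · refine Measurable.neg (Monotone.measurable fun a b hab => ?_)
    exact measureReal_mono (Set.Iic_subset_Iic.2 hab)

/-- A law with tails `O(|t|⁻⁴)` integrates every `C¹` function whose derivative grows at most
linearly, and the expectation is determined by the tails. -/
lemma integrable_and_integral_eq_of_signedTail_le {ν : Measure ℝ} [IsProbabilityMeasure ν] {C : ℝ}
    (hν : ∀ t, |signedTail ν t| ≤ C * (1 + |t|) ^ (-4 : ℝ)) {g g' : ℝ → ℝ} {D : ℝ}
    (hg : ∀ t, HasDerivAt g (g' t) t) (hg' : Continuous g') (hD : ∀ t, |g' t| ≤ D * (1 + |t|)) :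
    Integrable g ν ∧ ∫ z, g z ∂ν = g 0 + ∫ t, g' t * signedTail ν t := by
  have hint : Integrable (fun p : ℝ × ℝ => g' p.2 * signedBeyond p.1 p.2) (ν.prod volume) := by
    have hm : Measurable fun p : ℝ × ℝ => g' p.2 * signedBeyond p.1 p.2 :=
      (hg'.measurable.comp measurable_snd).mul measurable_signedBeyond
    rw [integrable_prod_iff' hm.aestronglyMeasurable]
    constructor
    · refine ae_of_all _ fun t => Integrable.of_bound
        (hm.comp (measurable_id.prodMk measurable_const)).aestronglyMeasurable |g' t|
        (ae_of_all _ fun z => ?_)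
      rw [Real.norm_eq_abs, abs_mul]
      exact mul_le_of_le_one_right (abs_nonneg _) (abs_signedBeyond_le _ _)
    · simp only [Real.norm_eq_abs, abs_mul, integral_const_mul, integral_abs_signedBeyond]
      refine (integrable_one_add_abs_rpow_neg_three.const_mul (D * C)).mono'
        ((hg'.measurable.abs.mul (measurable_signedTail ν).abs).aestronglyMeasurable)
        (ae_of_all _ fun t => ?_)
      have h0 : 0 < 1 + |t| := by positivity
      rw [Real.norm_eq_abs, abs_mul, abs_abs, abs_abs]
      calc |g' t| * |signedTail ν t| ≤ (D * (1 + |t|)) * (C * (1 + |t|) ^ (-4 : ℝ)) :=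
            mul_le_mul (hD t) (hν t) (abs_nonneg _) ((abs_nonneg _).trans (hD t))
        _ = D * C * ((1 + |t|) ^ (1 : ℝ) * (1 + |t|) ^ (-4 : ℝ)) := by rw [Real.rpow_one]; ring
        _ = D * C * (1 + |t|) ^ (-3 : ℝ) := by rw [← Real.rpow_add h0]; norm_num
  have h1 : Integrable (fun z => g z - g 0) ν := by
    simpa only [integral_mul_signedBeyond hg hg'] using hint.integral_prod_left
  have h2 : Integrable g ν :=
    (h1.add (integrable_const (g 0))).congr (ae_of_all _ fun z => by simp)
  refine ⟨h2, ?_⟩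
  have h3 := integral_integral_swap (f := fun z t => g' t * signedBeyond z t) hint
  simp only [integral_mul_signedBeyond hg hg', integral_const_mul, integral_signedBeyond] at h3
  rw [integral_sub h2 (integrable_const _)] at h3
  simp only [integral_const, probReal_univ, one_smul] at h3
  linarith

/-- Convergence of the tails, under a uniform bound `O(|t|⁻⁴)`, gives convergence of expectations
of `C¹` functions whose derivative grows at most linearly. -/
lemma tendsto_integral_of_tendsto_signedTail {ν : ℕ → Measure ℝ} [∀ n, IsProbabilityMeasure (ν n)]
    {ν' : Measure ℝ} [IsProbabilityMeasure ν'] {C : ℝ} {n₀ : ℕ}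
    (hν : ∀ n, n₀ ≤ n → ∀ t, |signedTail (ν n) t| ≤ C * (1 + |t|) ^ (-4 : ℝ))
    (hlim : ∀ t, Tendsto (fun n => signedTail (ν n) t) atTop (𝓝 (signedTail ν' t)))
    {g g' : ℝ → ℝ} {D : ℝ}
    (hg : ∀ t, HasDerivAt g (g' t) t) (hg' : Continuous g') (hD : ∀ t, |g' t| ≤ D * (1 + |t|)) :
    Tendsto (fun n => ∫ z, g z ∂ν n) atTop (𝓝 (∫ z, g z ∂ν')) := by
  have hν' (t : ℝ) : |signedTail ν' t| ≤ C * (1 + |t|) ^ (-4 : ℝ) :=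
    le_of_tendsto (hlim t).abs (eventually_atTop.2 ⟨n₀, fun n hn => hν n hn t⟩)
  rw [(integrable_and_integral_eq_of_signedTail_le hν' hg hg' hD).2]
  have hev : ∀ᶠ n in atTop, g 0 + ∫ t, g' t * signedTail (ν n) t = ∫ z, g z ∂ν n :=
    eventually_atTop.2 ⟨n₀, fun n hn =>
      (integrable_and_integral_eq_of_signedTail_le (hν n hn) hg hg' hD).2.symm⟩
  refine Tendsto.congr' hev (Tendsto.const_add _ ?_)
  refine tendsto_integral_filter_of_dominated_convergence
    (fun t => D * C * (1 + |t|) ^ (-3 : ℝ)) ?_ ?_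
    (integrable_one_add_abs_rpow_neg_three.const_mul (D * C))
    (ae_of_all _ fun t => (hlim t).const_mul _)
  · exact Eventually.of_forall fun n =>
      (hg'.measurable.mul (measurable_signedTail _)).aestronglyMeasurable
  · refine eventually_atTop.2 ⟨n₀, fun n hn => ae_of_all _ fun t => ?_⟩
    have h0 : 0 < 1 + |t| := by positivity
    rw [Real.norm_eq_abs, abs_mul]
    calc |g' t| * |signedTail (ν n) t| ≤ (D * (1 + |t|)) * (C * (1 + |t|) ^ (-4 : ℝ)) :=
          mul_le_mul (hD t) (hν n hn t) (abs_nonneg _) ((abs_nonneg _).trans (hD t))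
      _ = D * C * ((1 + |t|) ^ (1 : ℝ) * (1 + |t|) ^ (-4 : ℝ)) := by rw [Real.rpow_one]; ring
      _ = D * C * (1 + |t|) ^ (-3 : ℝ) := by rw [← Real.rpow_add h0]; norm_num

/-! ### Binomial counts -/

lemma integral_ite_le_const {E : Type*} [NormedAddCommGroup E] [NormedSpace ℝ E]
    [CompleteSpace E] (γ : Measure ℝ) [IsProbabilityMeasure γ] (s : ℝ) (a b : E) :
    ∫ x, (if x ≤ s then a else b) ∂γ = γ.real (Set.Iic s) • a + (1 - γ.real (Set.Iic s)) • b := by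
  have h : (fun x : ℝ => if x ≤ s then a else b) =
      fun x => (Set.Iic s).indicator (fun _ => a - b) x + b := by
    ext x
    by_cases hx : x ≤ s <;> simp [hx]
  rw [h, integral_add ((integrable_const _).indicator measurableSet_Iic) (integrable_const _),
    integral_indicator_const _ measurableSet_Iic, integral_const, probReal_univ]
  module

/-- The number of observations that are at most `s`, minus half of the sample size. -/
noncomputable def centredCount (s : ℝ) {N : ℕ} (x : Fin N → ℝ) : ℝ :=
  ∑ i, if x i ≤ s then (1 / 2 : ℝ) else -(1 / 2)

lemma measurable_half_ite (s : ℝ) :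
    Measurable fun x : ℝ => if x ≤ s then (1 / 2 : ℝ) else -(1 / 2) :=
  Measurable.ite measurableSet_Iic measurable_const measurable_const

lemma measurable_half_ite_apply (s : ℝ) {N : ℕ} (i : Fin N) :
    Measurable fun x : Fin N → ℝ => if x i ≤ s then (1 / 2 : ℝ) else -(1 / 2) :=
  (measurable_half_ite s).comp (measurable_pi_apply i)

lemma measurable_centredCount (s : ℝ) {N : ℕ} :
    Measurable (centredCount s : (Fin N → ℝ) → ℝ) :=
  Finset.measurable_fun_sum _ fun i _ => measurable_half_ite_apply s i

lemma centredCount_eq (s : ℝ) {N : ℕ} (x : Fin N → ℝ) :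
    centredCount s x = (Finset.univ.filter fun i => x i ≤ s).card - (N : ℝ) / 2 := by
  have h (i : Fin N) : (if x i ≤ s then (1 / 2 : ℝ) else -(1 / 2)) =
      (if x i ≤ s then 1 else 0) - 1 / 2 := by split_ifs <;> norm_num
  simp only [centredCount, h, Finset.sum_sub_distrib, Finset.sum_boole, Finset.sum_const,
    Finset.card_univ, Fintype.card_fin, nsmul_eq_mul]
  ring

lemma centredCount_nonneg_of_sampleMedian_le {N : ℕ} {x : Fin N → ℝ} {s : ℝ}
    (h : sampleMedian x ≤ s) : 0 ≤ centredCount s x := by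
  have h1 : (N : ℝ) ≤ 2 * ((Finset.univ.filter fun i => x i ≤ s).card : ℝ) := by
    exact_mod_cast le_two_mul_card_of_sampleMedian_le x h
  rw [centredCount_eq]
  linarith

lemma sampleMedian_le_of_centredCount_pos {N : ℕ} {x : Fin N → ℝ} {s : ℝ}
    (h : 0 < centredCount s x) : sampleMedian x ≤ s := by
  rw [centredCount_eq] at h
  refine sampleMedian_le_of_lt_two_mul_card x ?_
  have h1 : (N : ℝ) < 2 * ((Finset.univ.filter fun i => x i ≤ s).card : ℝ) := by linarith
  exact_mod_cast h1

section Count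

variable (γ : Measure ℝ) [IsProbabilityMeasure γ] (s : ℝ) (N : ℕ)

lemma iIndepFun_half_ite :
    iIndepFun (fun (i : Fin N) (x : Fin N → ℝ) => if x i ≤ s then (1 / 2 : ℝ) else -(1 / 2))
      (Measure.pi fun _ => γ) :=
  iIndepFun_pi (X := fun _ : Fin N => fun x : ℝ => if x ≤ s then (1 / 2 : ℝ) else -(1 / 2))
    fun _ => (measurable_half_ite s).aemeasurable

lemma map_half_ite (i : Fin N) :
    (Measure.pi fun _ : Fin N => γ).map (fun x => if x i ≤ s then (1 / 2 : ℝ) else -(1 / 2)) =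
      γ.map fun x => if x ≤ s then (1 / 2 : ℝ) else -(1 / 2) := by
  conv_rhs => rw [← (measurePreserving_eval (fun _ : Fin N => γ) i).map_eq]
  rw [Measure.map_map (measurable_half_ite s) (measurable_pi_apply i)]
  rfl

lemma charFun_map_centredCount (u : ℝ) :
    charFun ((Measure.pi fun _ : Fin N => γ).map (centredCount s)) u =
      (γ.real (Set.Iic s) * Complex.exp (u / 2 * Complex.I) +
        (1 - γ.real (Set.Iic s)) * Complex.exp (-(u / 2) * Complex.I)) ^ N := by
  have h1 := (iIndepFun_half_ite γ s N).charFun_map_fun_sum_eq_prod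
    fun i => (measurable_half_ite_apply s i).aemeasurable
  have h2 : charFun (γ.map fun x => if x ≤ s then (1 / 2 : ℝ) else -(1 / 2)) u =
      γ.real (Set.Iic s) * Complex.exp (u / 2 * Complex.I) +
        (1 - γ.real (Set.Iic s)) * Complex.exp (-(u / 2) * Complex.I) := by
    rw [charFun_apply_real, integral_map (measurable_half_ite s).aemeasurable (by fun_prop)]
    have h3 (x : ℝ) : Complex.exp (u * ((if x ≤ s then (1 / 2 : ℝ) else -(1 / 2) : ℝ) : ℂ)
        * Complex.I) = if x ≤ s then Complex.exp (u / 2 * Complex.I)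
          else Complex.exp (-(u / 2) * Complex.I) := by
      split_ifs <;> congr 1 <;> push_cast <;> ring
    simp_rw [h3]
    rw [integral_ite_le_const]
    simp
  unfold centredCount
  rw [h1, Finset.prod_apply]
  simp only [map_half_ite, h2, Finset.prod_const, Finset.card_univ, Fintype.card_fin]

lemma mgf_centredCount (r : ℝ) :
    mgf (centredCount s) (Measure.pi fun _ : Fin N => γ) r =
      (γ.real (Set.Iic s) * Real.exp (r / 2) +
        (1 - γ.real (Set.Iic s)) * Real.exp (-(r / 2))) ^ N := by
  have h1 := (iIndepFun_half_ite γ s N).mgf_sum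
    (fun i => measurable_half_ite_apply s i) Finset.univ (t := r)
  have h2 (i : Fin N) : mgf (fun x : Fin N → ℝ => if x i ≤ s then (1 / 2 : ℝ) else -(1 / 2))
      (Measure.pi fun _ => γ) r = γ.real (Set.Iic s) * Real.exp (r / 2) +
        (1 - γ.real (Set.Iic s)) * Real.exp (-(r / 2)) := by
    rw [← mgf_id_map (measurable_half_ite_apply s i).aemeasurable,
      map_half_ite, mgf_id_map (measurable_half_ite s).aemeasurable, mgf]
    have h3 (x : ℝ) : Real.exp (r * (if x ≤ s then (1 / 2 : ℝ) else -(1 / 2))) =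
        if x ≤ s then Real.exp (r / 2) else Real.exp (-(r / 2)) := by
      split_ifs <;> congr 1 <;> ring
    simp_rw [h3]
    rw [integral_ite_le_const]
    simp
  have h4 : (∑ i : Fin N, fun x : Fin N → ℝ => if x i ≤ s then (1 / 2 : ℝ) else -(1 / 2)) =
      centredCount s := by
    ext x
    simp [centredCount, Finset.sum_apply]
  rw [h4] at h1
  rw [h1]
  simp only [h2, Finset.prod_const, Finset.card_univ, Fintype.card_fin]

lemma integrable_exp_mul_centredCount (r : ℝ) :
    Integrable (fun x => Real.exp (r * centredCount s x)) (Measure.pi fun _ : Fin N => γ) := by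
  refine Integrable.of_bound
    (Real.measurable_exp.comp ((measurable_centredCount s).const_mul r)).aestronglyMeasurable
    (Real.exp (|r| * (N / 2))) (ae_of_all _ fun x => ?_)
  rw [Real.norm_eq_abs, Real.abs_exp, Real.exp_le_exp]
  refine (le_abs_self _).trans ?_
  rw [abs_mul]
  gcongr
  refine (Finset.abs_sum_le_sum_abs _ _).trans ?_
  refine (Finset.sum_le_sum fun i _ =>
    (show |if x i ≤ s then (1 / 2 : ℝ) else -(1 / 2)| ≤ 1 / 2 by split_ifs <;> simp)).trans ?_
  simp [div_eq_mul_inv]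

/-- The Chernoff bound at the optimal exponent, for counts on the improbable side of one half. -/
lemma sq_measureReal_centredCount_le {p : ℝ} (hp : γ.real (Set.Iic s) = p) (hp0 : 0 < p)
    (hp1 : p < 1) :
    (p ≤ 1 / 2 → (Measure.pi fun _ : Fin N => γ).real {x | 0 ≤ centredCount s x} ^ 2 ≤
      (4 * p * (1 - p)) ^ N) ∧
    (1 / 2 ≤ p → (Measure.pi fun _ : Fin N => γ).real {x | centredCount s x ≤ 0} ^ 2 ≤
      (4 * p * (1 - p)) ^ N) := by
  set r := Real.log ((1 - p) / p) with hr
  have hq : 0 < (1 - p) / p := div_pos (by linarith) hp0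
  have hbase : (p * Real.exp (r / 2) + (1 - p) * Real.exp (-(r / 2))) ^ 2 = 4 * p * (1 - p) := by
    have h1 : Real.exp (r / 2) ^ 2 = (1 - p) / p := by
      rw [← Real.exp_nat_mul]
      push_cast
      rw [mul_div_cancel₀ _ two_ne_zero, hr, Real.exp_log hq]
    have h2 : Real.exp (-(r / 2)) = (Real.exp (r / 2))⁻¹ := Real.exp_neg _
    have h3 : Real.exp (r / 2) ≠ 0 := (Real.exp_pos _).ne'
    have h4 : 1 - p = p * Real.exp (r / 2) ^ 2 := by rw [h1]; field_simp
    rw [h2]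
    have h5 : p * Real.exp (r / 2) + (1 - p) * (Real.exp (r / 2))⁻¹ =
        2 * p * Real.exp (r / 2) := by
      rw [h4]; field_simp; ring
    rw [h5, mul_pow, h1]
    field_simp
    ring
  have hmgf : mgf (centredCount s) (Measure.pi fun _ : Fin N => γ) r ^ 2 =
      (4 * p * (1 - p)) ^ N := by
    rw [mgf_centredCount, hp, ← pow_mul, mul_comm N 2, pow_mul, hbase]
  rw [← hmgf]
  constructor
  · intro h
    have hr0 : 0 ≤ r := Real.log_nonneg (by rw [le_div_iff₀ hp0]; linarith)
    have := measure_ge_le_exp_mul_mgf (X := centredCount s) 0 hr0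
      (integrable_exp_mul_centredCount γ s N r)
    rw [mul_zero, Real.exp_zero, one_mul] at this
    exact pow_le_pow_left₀ measureReal_nonneg this 2
  · intro h
    have hr0 : r ≤ 0 := Real.log_nonpos hq.le (by rw [div_le_iff₀ hp0]; linarith)
    have := measure_le_le_exp_mul_mgf (X := centredCount s) 0 hr0
      (integrable_exp_mul_centredCount γ s N r)
    rw [mul_zero, Real.exp_zero, one_mul] at this
    exact pow_le_pow_left₀ measureReal_nonneg this 2

end Count

/-- A central limit theorem for counts whose success probability approaches one half at rate
`1 / √N`: the drift `c` of the probability shifts the limit. -/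
lemma tendsto_charFun_centredCount (γ : Measure ℝ) [IsProbabilityMeasure γ] (s : ℕ → ℝ) (c : ℝ)
    (hs : Tendsto (fun N : ℕ => √(N : ℝ) * (2 * γ.real (Set.Iic (s N)) - 1)) atTop (𝓝 c))
    (u : ℝ) :
    Tendsto (fun N : ℕ => charFun ((Measure.pi fun _ : Fin N => γ).map
      fun x => (√(N : ℝ))⁻¹ * centredCount (s N) x) u) atTop
      (𝓝 (charFun (gaussianReal (c / 2) (1 / 4)) u)) := by
  have hsq : Tendsto (fun N : ℕ => √(N : ℝ)) atTop atTop :=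
    Real.tendsto_sqrt_atTop.comp tendsto_natCast_atTop_atTop
  set θ : ℕ → ℝ := fun N => u / 2 * (√(N : ℝ))⁻¹ with hθ
  set p : ℕ → ℝ := fun N => γ.real (Set.Iic (s N)) with hp
  have hθ0 : Tendsto θ atTop (𝓝 0) := by
    simpa using hsq.inv_tendsto_atTop.const_mul (u / 2)
  have hθs : ∀ᶠ N : ℕ in atTop, √(N : ℝ) * θ N = u / 2 := by
    filter_upwards [eventually_gt_atTop 0] with N hN
    have : √(N : ℝ) ≠ 0 := (Real.sqrt_pos.2 (by exact_mod_cast hN)).ne'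
    simp only [hθ]; field_simp
  have hθ2 : ∀ᶠ N : ℕ in atTop, (N : ℝ) * θ N ^ 2 = u ^ 2 / 4 := by
    filter_upwards [hθs] with N hN
    have h : (√(N : ℝ) * θ N) ^ 2 = N * θ N ^ 2 := by
      rw [mul_pow _ (θ N), Real.sq_sqrt (Nat.cast_nonneg N)]
    rw [← h, hN]
    ring
  -- second-order expansion of the cosine
  have hcos : Tendsto (fun N : ℕ => (N : ℝ) * (Real.cos (θ N) - 1)) atTop (𝓝 (-(u ^ 2 / 8))) := by
    have hb : ∀ᶠ N : ℕ in atTop, |(N : ℝ) * (Real.cos (θ N) - 1) - -(u ^ 2 / 8)| ≤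
        u ^ 2 / 4 * (θ N ^ 2 * (5 / 96)) := by
      filter_upwards [hθ2, hθ0.abs.eventually (ge_mem_nhds (by norm_num : |(0 : ℝ)| < 1))]
        with N hN h1
      have h2 := Real.cos_bound h1
      have h3 : (N : ℝ) * (Real.cos (θ N) - 1) - -(u ^ 2 / 8) =
          N * (Real.cos (θ N) - (1 - θ N ^ 2 / 2)) := by linear_combination (-1 / 2) * hN
      rw [h3, abs_mul, Nat.abs_cast, ← hN]
      calc (N : ℝ) * |Real.cos (θ N) - (1 - θ N ^ 2 / 2)| ≤ N * (|θ N| ^ 4 * (5 / 96)) := by gcongr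
        _ = N * θ N ^ 2 * (θ N ^ 2 * (5 / 96)) := by
            rw [show |θ N| ^ 4 = (|θ N| ^ 2) ^ 2 by ring, sq_abs]; ring
    refine tendsto_iff_norm_sub_tendsto_zero.2 (squeeze_zero' (Eventually.of_forall fun _ =>
      norm_nonneg _) hb ?_)
    simpa using ((hθ0.pow 2).mul_const (5 / 96)).const_mul (u ^ 2 / 4)
  have hsin : Tendsto (fun N : ℕ => √(N : ℝ) * Real.sin (θ N)) atTop (𝓝 (u / 2)) := by
    have h := ((Real.continuous_sinc.tendsto 0).comp hθ0).const_mul (u / 2)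
    rw [Real.sinc_zero, mul_one] at h
    refine h.congr' ?_
    filter_upwards [hθs] with N hN
    rw [Function.comp_apply, ← hN, mul_assoc]
    congr 1
    rcases eq_or_ne (θ N) 0 with h0 | h0
    · simp [h0]
    · rw [Real.sinc_of_ne_zero h0, mul_div_cancel₀ _ h0]
  have hN (N : ℕ) : charFun ((Measure.pi fun _ : Fin N => γ).map
      fun x => (√(N : ℝ))⁻¹ * centredCount (s N) x) u =
      (1 + (((Real.cos (θ N) - 1 : ℝ) : ℂ) +
        (((2 * p N - 1) * Real.sin (θ N) : ℝ) : ℂ) * Complex.I)) ^ N := by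
    have : (fun x : Fin N → ℝ => (√(N : ℝ))⁻¹ * centredCount (s N) x) =
        (fun y => (√(N : ℝ))⁻¹ * y) ∘ centredCount (s N) := rfl
    rw [this, ← Measure.map_map (measurable_const_mul _) (measurable_centredCount _),
      charFun_map_mul, charFun_map_centredCount]
    congr 1
    have e1 : (((√(N : ℝ))⁻¹ * u : ℝ) : ℂ) / 2 = (θ N : ℂ) := by
      simp only [hθ]; push_cast; ring
    rw [e1, Complex.exp_mul_I, Complex.exp_mul_I, Complex.cos_neg, Complex.sin_neg]
    push_cast
    ring
  simp_rw [hN]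
  rw [charFun_gaussianReal]
  refine Complex.tendsto_one_add_pow_exp_of_tendsto ?_
  have h1 : Tendsto (fun N : ℕ => (N : ℝ) * ((2 * p N - 1) * Real.sin (θ N))) atTop
      (𝓝 (c * (u / 2))) := by
    refine (hs.mul hsin).congr fun N => ?_
    simp only [hp]
    linear_combination ((2 * γ.real (Set.Iic (s N)) - 1) * Real.sin (θ N)) *
      Real.mul_self_sqrt (Nat.cast_nonneg N : (0 : ℝ) ≤ N)
  have h2 := (((Complex.continuous_ofReal.tendsto _).comp hcos).add
    (((Complex.continuous_ofReal.tendsto _).comp h1).mul_const Complex.I))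
  convert h2 using 2
  · simp only [Function.comp]; push_cast; ring
  · push_cast; ring

/-! ### The sample median of the log-exponential law -/

/-- Bernoulli's inequality `2 ^ w ≤ 1 + w` on `[0, 1]` and its reverse on `[1, ∞)`, at `w = exp s`,
keep the distribution function of the logarithm of an exponential variable away from `1 / 2`. -/
lemma abs_div_le_abs_two_mul_exp_sub_one (s : ℝ) :
    |s| / (2 + |s|) ≤ |2 * Real.exp (-(Real.log 2 * Real.exp s)) - 1| := by
  set w := Real.exp s with hw
  have hw0 : 0 < w := Real.exp_pos s
  have h2w : Real.exp (-(Real.log 2 * w)) = (2 ^ w)⁻¹ := by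
    rw [Real.exp_neg, Real.rpow_def_of_pos two_pos]
  have h2pos : (0 : ℝ) < 2 ^ w := Real.rpow_pos_of_pos two_pos w
  have hs0 : 0 < 2 + |s| := by positivity
  rw [h2w]
  rcases le_total 0 s with h | h
  · have hb := one_add_mul_self_le_rpow_one_add (s := 1) (by norm_num) (p := w)
      (Real.one_le_exp h)
    norm_num at hb
    have hw1 : 1 + s ≤ w := by linarith [Real.add_one_le_exp s]
    have h3 : (2 ^ w)⁻¹ ≤ (1 + w)⁻¹ := inv_anti₀ (by linarith) hb
    refine le_trans ?_ (neg_le_abs _)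
    rw [abs_of_nonneg h]
    have h4 : s / (2 + s) ≤ 1 - 2 * (1 + w)⁻¹ := by
      rw [div_le_iff₀ (by linarith), ← sub_nonneg]
      have : (1 - 2 * (1 + w)⁻¹) * (2 + s) - s = 2 * (w - (1 + s)) / (1 + w) := by
        field_simp; ring
      rw [this]
      exact div_nonneg (by linarith) (by linarith)
    linarith
  · have hb := rpow_one_add_le_one_add_mul_self (s := 1) (by norm_num) (p := w) hw0.le
      (Real.exp_le_one_iff.2 h)
    norm_num at hb
    have hw1 : w * (1 - s) ≤ 1 := by
      have h5 := Real.add_one_le_exp (-s)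
      have h6 : w * Real.exp (-s) = 1 := by rw [hw, ← Real.exp_add]; simp
      nlinarith
    have h3 : (1 + w)⁻¹ ≤ (2 ^ w)⁻¹ := inv_anti₀ h2pos hb
    refine le_trans ?_ (le_abs_self _)
    rw [abs_of_nonpos h]
    have h4 : -s / (2 + -s) ≤ 2 * (1 + w)⁻¹ - 1 := by
      rw [div_le_iff₀ (by linarith), ← sub_nonneg]
      have : (2 * (1 + w)⁻¹ - 1) * (2 + -s) - -s = 2 * (1 - w * (1 - s)) / (1 + w) := by
        field_simp; ring
      rw [this]
      exact div_nonneg (by linarith) (by linarith)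
    linarith

section LogExponential

variable {γ : Measure ℝ}

lemma cdf_at_median_add (hγ : ∀ x, γ.real (Set.Iic x) = 1 - Real.exp (-Real.exp x)) (s : ℝ) :
    γ.real (Set.Iic (Real.log (Real.log 2) + s)) =
      1 - Real.exp (-(Real.log 2 * Real.exp s)) := by
  rw [hγ, Real.exp_add, Real.exp_log (Real.log_pos one_lt_two)]

/-- The distribution function has derivative `log 2 / 2` at the median. -/
lemma tendsto_sqrt_mul_cdf (hγ : ∀ x, γ.real (Set.Iic x) = 1 - Real.exp (-Real.exp x)) (t : ℝ) :
    Tendsto (fun N : ℕ => √(N : ℝ) *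
      (2 * γ.real (Set.Iic (Real.log (Real.log 2) + t / √(N : ℝ))) - 1)) atTop
      (𝓝 (Real.log 2 * t)) := by
  have hd : HasDerivAt (fun y : ℝ => 1 - 2 * Real.exp (-(Real.log 2 * Real.exp (t * y))))
      (Real.log 2 * t) 0 := by
    have h1 : HasDerivAt (fun y : ℝ => t * y) t 0 := by
      simpa using (hasDerivAt_id (0 : ℝ)).const_mul t
    have h2 := (((h1.exp.const_mul (Real.log 2)).fun_neg).exp.const_mul 2).const_sub 1
    convert! h2 using 1
    simp only [mul_zero, Real.exp_zero, mul_one, Real.exp_neg, Real.exp_log two_pos]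
    ring
  have h3 := hasDerivAt_iff_tendsto_slope_zero.1 hd
  have h4 : Tendsto (fun N : ℕ => (√(N : ℝ))⁻¹) atTop (𝓝[≠] 0) := by
    refine tendsto_nhdsWithin_iff.2 ⟨(Real.tendsto_sqrt_atTop.comp
      tendsto_natCast_atTop_atTop).inv_tendsto_atTop, ?_⟩
    filter_upwards [eventually_gt_atTop 0] with N hN
    exact inv_ne_zero (Real.sqrt_pos.2 (by exact_mod_cast hN)).ne'
  refine (h3.comp h4).congr fun N => ?_
  simp only [Function.comp, cdf_at_median_add hγ, inv_inv, smul_eq_mul, zero_add, mul_zero,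
    Real.exp_zero, mul_one, Real.exp_neg, Real.exp_log two_pos, div_eq_mul_inv]
  ring

/-- The law of the rescaled sample median of `N` independent observations from `γ`, centred at
`log (log 2)`, the median of the log-exponential law, whatever `γ` is. -/
noncomputable def medianLaw (γ : Measure ℝ) (N : ℕ) : Measure ℝ :=
  (Measure.pi fun _ : Fin N => γ).map
    fun x => √(N : ℝ) * (sampleMedian x - Real.log (Real.log 2))

lemma measurable_medianLaw_aux (N : ℕ) : Measurable fun x : Fin N → ℝ =>
    √(N : ℝ) * (sampleMedian x - Real.log (Real.log 2)) :=
  (measurable_sampleMedian.sub_const _).const_mul _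

lemma medianLaw_real_Iic {N : ℕ} (hN : 0 < N) (t : ℝ) :
    (medianLaw γ N).real (Set.Iic t) = (Measure.pi fun _ : Fin N => γ).real
      {x | sampleMedian x ≤ Real.log (Real.log 2) + t / √(N : ℝ)} := by
  rw [medianLaw, map_measureReal_apply (measurable_medianLaw_aux N) measurableSet_Iic]
  congr 1
  ext x
  have h : 0 < √(N : ℝ) := Real.sqrt_pos.2 (by exact_mod_cast hN)
  simp only [Set.mem_preimage, Set.mem_Iic, Set.mem_ofPred_eq]
  rw [← sub_le_iff_le_add', le_div_iff₀ h, mul_comm]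

variable [IsProbabilityMeasure γ]

instance isProbabilityMeasure_medianLaw (N : ℕ) : IsProbabilityMeasure (medianLaw γ N) :=
  Measure.isProbabilityMeasure_map (measurable_medianLaw_aux N).aemeasurable

lemma real_Ioi_eq_one_sub (ν : Measure ℝ) [IsProbabilityMeasure ν] (t : ℝ) :
    ν.real (Set.Ioi t) = 1 - ν.real (Set.Iic t) := by
  rw [← Set.compl_Iic, probReal_compl_eq_one_sub measurableSet_Iic]

lemma medianLaw_real_Iic_le {N : ℕ} (hN : 0 < N) (t : ℝ) :
    (medianLaw γ N).real (Set.Iic t) ≤ (Measure.pi fun _ : Fin N => γ).real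
      {x | 0 ≤ centredCount (Real.log (Real.log 2) + t / √(N : ℝ)) x} := by
  rw [medianLaw_real_Iic hN]
  exact measureReal_mono fun x hx => centredCount_nonneg_of_sampleMedian_le hx

lemma le_medianLaw_real_Iic {N : ℕ} (hN : 0 < N) (t : ℝ) :
    (Measure.pi fun _ : Fin N => γ).real
      {x | 0 < centredCount (Real.log (Real.log 2) + t / √(N : ℝ)) x} ≤
      (medianLaw γ N).real (Set.Iic t) := by
  rw [medianLaw_real_Iic hN]
  exact measureReal_mono fun x hx => sampleMedian_le_of_centredCount_pos hx

/-- Chernoff's bound for the number of observations beyond the level `log (log 2) + t / √N`. -/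
lemma sq_signedTail_medianLaw_le
    (hγ : ∀ x, γ.real (Set.Iic x) = 1 - Real.exp (-Real.exp x)) {N : ℕ} (hN : 0 < N) (t : ℝ) :
    signedTail (medianLaw γ N) t ^ 2 ≤
      (1 - (2 * Real.exp (-(Real.log 2 * Real.exp (t / √(N : ℝ)))) - 1) ^ 2) ^ N := by
  set s := t / √(N : ℝ) with hs
  set e := Real.exp (-(Real.log 2 * Real.exp s)) with he
  have hsq : 0 < √(N : ℝ) := Real.sqrt_pos.2 (by exact_mod_cast hN)
  have hL : 0 < Real.log 2 := Real.log_pos one_lt_two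
  have hp := cdf_at_median_add hγ s
  rw [← he] at hp
  have he0 : 0 < e := Real.exp_pos _
  have he1 : e < 1 := Real.exp_lt_one_iff.2 (by simp only [neg_lt_zero]; positivity)
  have hehalf : Real.exp (-Real.log 2) = 1 / 2 := by
    rw [Real.exp_neg, Real.exp_log two_pos]; norm_num
  obtain ⟨h1, h2⟩ := sq_measureReal_centredCount_le γ (Real.log (Real.log 2) + s) N hp
    (by linarith) (by linarith)
  have h3 : 4 * (1 - e) * (1 - (1 - e)) = 1 - (2 * e - 1) ^ 2 := by ring
  rw [h3] at h1 h2
  unfold signedTail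
  split_ifs with ht
  · have hs0 : 0 ≤ s := div_nonneg ht.le hsq.le
    have : e ≤ 1 / 2 := by
      rw [← hehalf, he, Real.exp_le_exp]
      nlinarith [Real.one_le_exp hs0]
    refine le_trans ?_ (h2 (by linarith))
    refine pow_le_pow_left₀ measureReal_nonneg ?_ 2
    have h4 := le_medianLaw_real_Iic (γ := γ) hN t
    have h5 : {x : Fin N → ℝ | centredCount (Real.log (Real.log 2) + s) x ≤ 0} =
        {x | 0 < centredCount (Real.log (Real.log 2) + s) x}ᶜ := by
      ext x; simp
    rw [real_Ioi_eq_one_sub, h5, probReal_compl_eq_one_sub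
      (measurableSet_lt measurable_const (measurable_centredCount _))]
    linarith
  · have hs0 : s ≤ 0 := div_nonpos_of_nonpos_of_nonneg (not_lt.1 ht) hsq.le
    have : 1 / 2 ≤ e := by
      rw [← hehalf, he, Real.exp_le_exp]
      nlinarith [Real.exp_le_one_iff.2 hs0]
    rw [neg_sq]
    refine le_trans ?_ (h1 (by linarith))
    exact pow_le_pow_left₀ measureReal_nonneg (medianLaw_real_Iic_le hN t) 2

/-- Uniformly in the sample size, the rescaled median has tails `O(|t|⁻⁴)`: the squared tail
is at most `(1 + b / N) ^ (-N)` with `b = t ^ 2 / (4 + 4 * |t|)`, hence at most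
`(1 + b / 8) ^ (-8)`. -/
lemma abs_signedTail_medianLaw_le
    (hγ : ∀ x, γ.real (Set.Iic x) = 1 - Real.exp (-Real.exp x)) {N : ℕ} (hN : 8 ≤ N) (t : ℝ) :
    |signedTail (medianLaw γ N) t| ≤ 32 ^ 4 * (1 + |t|) ^ (-4 : ℝ) := by
  have hN0 : (0 : ℝ) < N := by exact_mod_cast (by omega : 0 < N)
  have hN1 : (8 : ℝ) ≤ N := by exact_mod_cast hN
  have hsq : 1 ≤ √(N : ℝ) := Real.one_le_sqrt.2 (by linarith)
  set b := t ^ 2 / (4 + 4 * |t|) with hb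
  have hb0 : 0 ≤ b := by positivity
  set s := t / √(N : ℝ) with hs
  set f := 2 * Real.exp (-(Real.log 2 * Real.exp s)) - 1 with hf
  have h1 : 1 - f ^ 2 ≤ (1 + b / N)⁻¹ := by
    have h2 := abs_div_le_abs_two_mul_exp_sub_one s
    rw [← hf] at h2
    have h3 : (|s| / (2 + |s|)) ^ 2 ≤ f ^ 2 := by
      rw [← sq_abs f]; exact pow_le_pow_left₀ (by positivity) h2 2
    have h4 : 1 - (|s| / (2 + |s|)) ^ 2 = (1 + |s| ^ 2 / (4 + 4 * |s|))⁻¹ := by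
      field_simp; ring
    have h5 : b / N ≤ |s| ^ 2 / (4 + 4 * |s|) := by
      have h6 : |s| ^ 2 = t ^ 2 / N := by
        rw [sq_abs, hs, div_pow, Real.sq_sqrt hN0.le]
      have h7 : |s| ≤ |t| := by
        rw [hs, abs_div, abs_of_pos (by linarith : 0 < √(N : ℝ))]
        exact div_le_self (abs_nonneg t) hsq
      rw [h6, hb, div_right_comm]
      gcongr
    calc 1 - f ^ 2 ≤ 1 - (|s| / (2 + |s|)) ^ 2 := by linarith
      _ = (1 + |s| ^ 2 / (4 + 4 * |s|))⁻¹ := h4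
      _ ≤ (1 + b / N)⁻¹ := inv_anti₀ (by positivity) (by linarith)
  have hf1 : 0 ≤ 1 - f ^ 2 := by
    have he0 := Real.exp_pos (-(Real.log 2 * Real.exp s))
    have he1 : Real.exp (-(Real.log 2 * Real.exp s)) ≤ 1 := Real.exp_le_one_iff.2 (by
      have := Real.log_pos one_lt_two
      have := Real.exp_pos s
      simp only [Left.neg_nonpos_iff]; positivity)
    nlinarith
  -- Bernoulli's inequality with exponent `N / 8`
  have h8 : (1 + b / 8) ^ 8 ≤ (1 + b / N) ^ N := by
    have h9 := one_add_mul_self_le_rpow_one_add (s := b / N)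
      (by have : 0 ≤ b / N := by positivity
          linarith) (p := N / 8) (by linarith)
    have h10 : (N : ℝ) / 8 * (b / N) = b / 8 := by field_simp
    rw [h10] at h9
    calc (1 + b / 8) ^ 8 ≤ ((1 + b / N) ^ ((N : ℝ) / 8)) ^ 8 :=
          pow_le_pow_left₀ (by positivity) h9 8
      _ = (1 + b / N) ^ N := by
          rw [← Real.rpow_natCast, ← Real.rpow_mul (by positivity), ← Real.rpow_natCast]
          congr 1
          push_cast
          ring
  have h11 : (1 + |t|) / 32 ≤ 1 + b / 8 := by
    rw [hb, ← sq_abs t]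
    have h0 := abs_nonneg t
    have : 1 + |t| ^ 2 / (4 + 4 * |t|) / 8 - (1 + |t|) / 32 =
        (31 + 30 * |t|) / (32 * (1 + |t|)) := by
      field_simp; ring
    have : 0 ≤ (31 + 30 * |t|) / (32 * (1 + |t|)) := by positivity
    linarith
  have h12 : ((1 + |t|) / 32) ^ 8 ≤ (1 + b / N) ^ N :=
    (pow_le_pow_left₀ (by positivity) h11 8).trans h8
  have h13 : signedTail (medianLaw γ N) t ^ 2 ≤ (((1 + |t|) / 32) ^ 4)⁻¹ ^ 2 := by
    calc signedTail (medianLaw γ N) t ^ 2 ≤ (1 - f ^ 2) ^ N :=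
          sq_signedTail_medianLaw_le hγ (by omega) t
      _ ≤ ((1 + b / N)⁻¹) ^ N := pow_le_pow_left₀ hf1 h1 N
      _ = ((1 + b / N) ^ N)⁻¹ := inv_pow _ _
      _ ≤ (((1 + |t|) / 32) ^ 8)⁻¹ := inv_anti₀ (by positivity) h12
      _ = (((1 + |t|) / 32) ^ 4)⁻¹ ^ 2 := by rw [inv_pow, ← pow_mul]
  have h14 := abs_le_of_sq_le_sq h13 (by positivity)
  refine h14.trans (le_of_eq ?_)
  rw [Real.rpow_neg (by positivity), show (4 : ℝ) = ((4 : ℕ) : ℝ) by norm_num, Real.rpow_natCast]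
  field_simp

/-- The limiting law of the rescaled sample median: the density of the observations at their
median `log (log 2)` is `log 2 / 2`. -/
noncomputable def medianLimit : Measure ℝ := gaussianReal 0 (1 / Real.log 2 ^ 2).toNNReal

instance isProbabilityMeasure_medianLimit : IsProbabilityMeasure medianLimit := by
  unfold medianLimit; infer_instance

/-- The Gaussian limit of the counts at drift `log 2 * t`, in terms of the limit of the medians. -/
lemma gaussianReal_eq_map_medianLimit (t : ℝ) :
    gaussianReal (Real.log 2 * t / 2) (1 / 4) =
      medianLimit.map fun y => Real.log 2 * t / 2 + -(Real.log 2 / 2) * y := by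
  have hL := Real.log_pos one_lt_two
  have h : (fun y : ℝ => Real.log 2 * t / 2 + -(Real.log 2 / 2) * y) =
      (fun y => Real.log 2 * t / 2 + y) ∘ fun y => -(Real.log 2 / 2) * y := rfl
  rw [h, ← Measure.map_map (measurable_const_add _) (measurable_const_mul _), medianLimit,
    gaussianReal_map_const_mul, gaussianReal_map_const_add]
  congr 1
  · simp
  · ext
    push_cast
    rw [Real.coe_toNNReal _ (by positivity)]
    field_simp
    norm_num

lemma gaussianReal_real_Ici_zero (t : ℝ) :
    (gaussianReal (Real.log 2 * t / 2) (1 / 4)).real (Set.Ici 0) =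
      medianLimit.real (Set.Iic t) := by
  have hL := Real.log_pos one_lt_two
  rw [gaussianReal_eq_map_medianLimit, map_measureReal_apply (by fun_prop) measurableSet_Ici]
  congr 1
  ext y
  simp only [Set.mem_preimage, Set.mem_Ici, Set.mem_Iic]
  rw [show Real.log 2 * t / 2 + -(Real.log 2 / 2) * y = Real.log 2 / 2 * (t - y) by ring,
    mul_nonneg_iff_of_pos_left (by positivity), sub_nonneg]

lemma real_Ioi_zero_gaussianReal (t : ℝ) :
    (gaussianReal (Real.log 2 * t / 2) (1 / 4)).real (Set.Ioi 0) =
      medianLimit.real (Set.Iic t) := by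
  have : NullSingletonClass (gaussianReal (Real.log 2 * t / 2) (1 / 4)) :=
    nullSingletonClass_gaussianReal (by norm_num)
  rw [← gaussianReal_real_Ici_zero]
  exact measureReal_congr Ioi_ae_eq_Ici

/-- The distribution function of the median lies between the probabilities that the centred count
is positive and that it is nonnegative; these have the same limit. -/
lemma tendsto_medianLaw_real_Iic
    (hγ : ∀ x, γ.real (Set.Iic x) = 1 - Real.exp (-Real.exp x)) (t : ℝ) :
    Tendsto (fun N => (medianLaw γ N).real (Set.Iic t)) atTop
      (𝓝 (medianLimit.real (Set.Iic t))) := by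
  set s : ℕ → ℝ := fun N => Real.log (Real.log 2) + t / √(N : ℝ) with hs
  have hm (N : ℕ) : Measurable fun x : Fin N → ℝ => (√(N : ℝ))⁻¹ * centredCount (s N) x :=
    (measurable_centredCount _).const_mul _
  let P (N : ℕ) : ProbabilityMeasure ℝ := ⟨(Measure.pi fun _ : Fin N => γ).map
    fun x => (√(N : ℝ))⁻¹ * centredCount (s N) x,
    Measure.isProbabilityMeasure_map (hm N).aemeasurable⟩
  let Q : ProbabilityMeasure ℝ := ⟨gaussianReal (Real.log 2 * t / 2) (1 / 4), inferInstance⟩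
  have hPQ : Tendsto P atTop (𝓝 Q) := ProbabilityMeasure.tendsto_of_tendsto_charFun fun u =>
    tendsto_charFun_centredCount γ s _ (tendsto_sqrt_mul_cdf hγ t) u
  have hQ : NullSingletonClass (gaussianReal (Real.log 2 * t / 2) (1 / 4)) :=
    nullSingletonClass_gaussianReal (by norm_num)
  have h1 := ProbabilityMeasure.tendsto_measure_of_null_frontier_of_tendsto' hPQ
    (E := Set.Ici 0) (by rw [frontier_Ici]; exact hQ.measure_singleton 0)
  have h2 := ProbabilityMeasure.tendsto_measure_of_null_frontier_of_tendsto' hPQ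
    (E := Set.Ioi 0) (by rw [frontier_Ioi]; exact hQ.measure_singleton 0)
  have h1' := (ENNReal.tendsto_toReal (measure_ne_top _ _)).comp h1
  have h2' := (ENNReal.tendsto_toReal (measure_ne_top _ _)).comp h2
  change Tendsto _ _ (𝓝 ((gaussianReal (Real.log 2 * t / 2) (1 / 4)).real (Set.Ici 0))) at h1'
  change Tendsto _ _ (𝓝 ((gaussianReal (Real.log 2 * t / 2) (1 / 4)).real (Set.Ioi 0))) at h2'
  rw [gaussianReal_real_Ici_zero] at h1'
  rw [real_Ioi_zero_gaussianReal] at h2'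
  refine tendsto_of_tendsto_of_tendsto_of_le_of_le' h2' h1' ?_ ?_
  · filter_upwards [eventually_gt_atTop 0] with N hN
    refine le_trans (le_of_eq ?_) (le_medianLaw_real_Iic hN t)
    change (Measure.map _ _).real _ = _
    rw [map_measureReal_apply (hm N) measurableSet_Ioi]
    congr 1
    ext x
    have h : 0 < (√(N : ℝ))⁻¹ := inv_pos.2 (Real.sqrt_pos.2 (by exact_mod_cast hN))
    simp [hs, h]
  · filter_upwards [eventually_gt_atTop 0] with N hN
    refine (medianLaw_real_Iic_le hN t).trans (le_of_eq ?_)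
    change _ = (Measure.map _ _).real _
    rw [map_measureReal_apply (hm N) measurableSet_Ici]
    congr 1
    ext x
    have h : 0 < (√(N : ℝ))⁻¹ := inv_pos.2 (Real.sqrt_pos.2 (by exact_mod_cast hN))
    simp only [Set.mem_ofPred_eq, Set.mem_preimage, Set.mem_Ici, hs]
    rw [mul_nonneg_iff_of_pos_left h]

/-- Expectations of `C¹` functions with derivative of at most linear growth converge along the
rescaled sample medians. This covers the first two moments and the characteristic function. -/
lemma tendsto_integral_medianLaw
    (hγ : ∀ x, γ.real (Set.Iic x) = 1 - Real.exp (-Real.exp x)) {g g' : ℝ → ℝ} {D : ℝ}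
    (hg : ∀ t, HasDerivAt g (g' t) t) (hg' : Continuous g') (hD : ∀ t, |g' t| ≤ D * (1 + |t|)) :
    Tendsto (fun N => ∫ z, g z ∂medianLaw γ N) atTop (𝓝 (∫ z, g z ∂medianLimit)) := by
  refine tendsto_integral_of_tendsto_signedTail (C := 32 ^ 4) (n₀ := 8)
    (fun N hN t => abs_signedTail_medianLaw_le hγ hN t) (fun t => ?_) hg hg' hD
  have h := tendsto_medianLaw_real_Iic hγ t
  unfold signedTail
  split_ifs with ht
  · simp only [real_Ioi_eq_one_sub]
    exact h.const_sub 1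
  · exact h.neg

lemma tendsto_integral_id_medianLaw
    (hγ : ∀ x, γ.real (Set.Iic x) = 1 - Real.exp (-Real.exp x)) :
    Tendsto (fun N => ∫ z, z ∂medianLaw γ N) atTop (𝓝 0) := by
  have h := tendsto_integral_medianLaw hγ (g := fun z => z) (g' := fun _ => 1) (D := 1)
    (fun t => hasDerivAt_id t) continuous_const (fun t => by simp)
  rwa [medianLimit, integral_id_gaussianReal] at h

lemma tendsto_integral_sq_medianLaw
    (hγ : ∀ x, γ.real (Set.Iic x) = 1 - Real.exp (-Real.exp x)) :
    Tendsto (fun N => ∫ z, z ^ 2 ∂medianLaw γ N) atTop (𝓝 (1 / Real.log 2 ^ 2)) := by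
  have h := tendsto_integral_medianLaw hγ (g := fun z => z ^ 2) (g' := fun z => 2 * z) (D := 2)
    (fun t => by simpa using hasDerivAt_pow 2 t) (by fun_prop)
    (fun t => by rw [abs_mul, abs_two]; linarith)
  have h2 : ∫ z, z ^ 2 ∂medianLimit = 1 / Real.log 2 ^ 2 := by
    have h3 := variance_fun_id_gaussianReal (μ := 0) (v := (1 / Real.log 2 ^ 2).toNNReal)
    rw [variance_of_integral_eq_zero (by fun_prop) (integral_id_gaussianReal),
      Real.coe_toNNReal _ (by positivity)] at h3
    exact h3
  rwa [h2] at h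

lemma tendsto_charFun_medianLaw
    (hγ : ∀ x, γ.real (Set.Iic x) = 1 - Real.exp (-Real.exp x)) (u : ℝ) :
    Tendsto (fun N => charFun (medianLaw γ N) u) atTop (𝓝 (charFun medianLimit u)) := by
  have hc (ν : Measure ℝ) [IsProbabilityMeasure ν] : charFun ν u =
      ((∫ z, Real.cos (u * z) ∂ν : ℝ) : ℂ) + ((∫ z, Real.sin (u * z) ∂ν : ℝ) : ℂ) * Complex.I := by
    have hcos : Integrable (fun z => Real.cos (u * z)) ν :=
      Integrable.of_bound (by fun_prop) 1 (ae_of_all _ fun z => Real.abs_cos_le_one _)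
    have hsin : Integrable (fun z => Real.sin (u * z)) ν :=
      Integrable.of_bound (by fun_prop) 1 (ae_of_all _ fun z => Real.abs_sin_le_one _)
    rw [charFun_apply_real, ← integral_complex_ofReal, ← integral_complex_ofReal,
      ← integral_mul_const, ← integral_add hcos.ofReal (hsin.ofReal.mul_const _)]
    refine integral_congr_ae (ae_of_all _ fun z => ?_)
    simp only [Complex.exp_mul_I]
    push_cast
    rfl
  have hu (t : ℝ) : HasDerivAt (fun z : ℝ => u * z) u t := by
    simpa using (hasDerivAt_id t).const_mul u
  have hb (a t : ℝ) (ha : |a| ≤ 1) : |a * u| ≤ |u| * (1 + |t|) := by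
    rw [abs_mul]
    nlinarith [abs_nonneg u, abs_nonneg t, mul_nonneg (abs_nonneg u) (abs_nonneg t)]
  have h1 := tendsto_integral_medianLaw hγ (g := fun z => Real.cos (u * z))
    (g' := fun z => -Real.sin (u * z) * u) (D := |u|)
    (fun t => (hu t).cos) (by fun_prop)
    (fun t => hb _ t (by rw [abs_neg]; exact Real.abs_sin_le_one _))
  have h2 := tendsto_integral_medianLaw hγ (g := fun z => Real.sin (u * z))
    (g' := fun z => Real.cos (u * z) * u) (D := |u|)
    (fun t => (hu t).sin) (by fun_prop) (fun t => hb _ t (Real.abs_cos_le_one _))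
  simp only [hc]
  exact ((Complex.continuous_ofReal.tendsto _).comp h1).add
    (((Complex.continuous_ofReal.tendsto _).comp h2).mul_const Complex.I)

/-- The logarithm of an exponential variable is square integrable. -/
lemma memLp_two_of_cdf (hγ : ∀ x, γ.real (Set.Iic x) = 1 - Real.exp (-Real.exp x)) :
    MemLp (fun z : ℝ => z) 2 γ := by
  rw [memLp_two_iff_integrable_sq (by fun_prop)]
  refine (integrable_and_integral_eq_of_signedTail_le (C := 4 ^ 4) (fun t => ?_)
    (g := fun z => z ^ 2) (g' := fun z => 2 * z) (D := 2)
    (fun t => by simpa using hasDerivAt_pow 2 t) (by fun_prop)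
    (fun t => by rw [abs_mul, abs_two]; linarith)).1
  have h1 : |signedTail γ t| ≤ Real.exp (-|t|) := by
    unfold signedTail
    split_ifs with ht
    · rw [real_Ioi_eq_one_sub, hγ, sub_sub_cancel, Real.abs_exp, Real.exp_le_exp, abs_of_pos ht]
      linarith [Real.add_one_le_exp t]
    · rw [abs_neg, abs_of_nonneg measureReal_nonneg, hγ, abs_of_nonpos (not_lt.1 ht), neg_neg]
      linarith [Real.add_one_le_exp (-Real.exp t)]
  refine h1.trans ?_
  have h2 : (1 + |t|) / 4 ≤ Real.exp (|t| / 4) := by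
    linarith [Real.add_one_le_exp (|t| / 4), abs_nonneg t]
  have h3 : ((1 + |t|) / 4) ^ 4 ≤ Real.exp |t| := by
    refine (pow_le_pow_left₀ (by positivity) h2 4).trans (le_of_eq ?_)
    rw [← Real.exp_nat_mul]
    congr 1
    push_cast
    ring
  rw [Real.rpow_neg (by positivity), show (-|t|) = -(|t|) from rfl, Real.exp_neg,
    show (4 : ℝ) ^ 4 * ((1 + |t|) ^ (4 : ℝ))⁻¹ = (((1 + |t|) / 4) ^ 4)⁻¹ by
      rw [show (1 + |t|) ^ (4 : ℝ) = (1 + |t|) ^ 4 by exact_mod_cast Real.rpow_natCast _ 4]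
      field_simp]
  exact inv_anti₀ (by positivity) h3

end LogExponential

/-! ### The log-energy of a pair of independent Gaussian variables -/

lemma measurable_logMeanEnergy : Measurable logMeanEnergy := by
  unfold logMeanEnergy
  fun_prop

lemma lintegral_Ioc_rayleigh {v : ℝ} (hv : 0 < v) {R : ℝ} (hR : 0 ≤ R) :
    ∫⁻ r in Set.Ioc 0 R, ENNReal.ofReal (r / v * Real.exp (-r ^ 2 / (2 * v))) =
      ENNReal.ofReal (1 - Real.exp (-R ^ 2 / (2 * v))) := by
  have hd (r : ℝ) : HasDerivAt (fun r => -Real.exp (-r ^ 2 / (2 * v)))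
      (r / v * Real.exp (-r ^ 2 / (2 * v))) r := by
    have h := ((((hasDerivAt_pow 2 r).fun_neg).div_const (2 * v)).exp).fun_neg
    convert! h using 1
    field_simp
    push_cast
    ring
  have hc : Continuous fun r : ℝ => r / v * Real.exp (-r ^ 2 / (2 * v)) := by fun_prop
  rw [← ofReal_integral_eq_lintegral_ofReal, ← intervalIntegral.integral_of_le hR,
    intervalIntegral.integral_eq_sub_of_hasDerivAt (fun r _ => hd r) (hc.intervalIntegrable _ _)]
  · congr 1
    simp
    ring
  · exact (hc.integrableOn_Icc).mono_set Set.Ioc_subset_Icc_self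
  · filter_upwards [ae_restrict_mem measurableSet_Ioc] with r hr
    have := hr.1
    simp only [Pi.zero_apply]
    positivity

/-- The squared modulus of a centred isotropic Gaussian pair is exponential, by integration in
polar coordinates. -/
lemma gaussianReal_prod_sq_add_sq_le {v : NNReal} (hv : v ≠ 0) {R : ℝ} (hR : 0 ≤ R) :
    ((gaussianReal 0 v).prod (gaussianReal 0 v)) {d | d.1 ^ 2 + d.2 ^ 2 ≤ R ^ 2} =
      ENNReal.ofReal (1 - Real.exp (-R ^ 2 / (2 * v))) := by
  have hv0 : (0 : ℝ) < v := by exact_mod_cast pos_iff_ne_zero.2 hv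
  have hS : MeasurableSet {d : ℝ × ℝ | d.1 ^ 2 + d.2 ^ 2 ≤ R ^ 2} :=
    measurableSet_le (by fun_prop) measurable_const
  rw [gaussianReal_of_var_ne_zero _ hv, prod_withDensity (measurable_gaussianPDF _ _)
    (measurable_gaussianPDF _ _), withDensity_apply _ hS, ← lintegral_indicator hS,
    ← Measure.volume_eq_prod, ← lintegral_comp_polarCoord_symm]
  have hpt (p : ℝ × ℝ) (hp : p ∈ polarCoord.target) :
      ENNReal.ofReal p.1 • ({d : ℝ × ℝ | d.1 ^ 2 + d.2 ^ 2 ≤ R ^ 2}).indicator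
        (fun z => gaussianPDF 0 v z.1 * gaussianPDF 0 v z.2) (polarCoord.symm p) =
      (Set.Ioc 0 R).indicator (fun r => ENNReal.ofReal (1 / (2 * Real.pi)) *
        ENNReal.ofReal (r / v * Real.exp (-r ^ 2 / (2 * v)))) p.1 := by
    have hr : 0 < p.1 := hp.1
    have hsq : (p.1 * Real.cos p.2) ^ 2 + (p.1 * Real.sin p.2) ^ 2 = p.1 ^ 2 := by
      linear_combination p.1 ^ 2 * Real.cos_sq_add_sin_sq p.2
    rw [polarCoord_symm_apply]
    by_cases h : p.1 ≤ R
    · have h1 : (p.1 * Real.cos p.2, p.1 * Real.sin p.2) ∈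
          {d : ℝ × ℝ | d.1 ^ 2 + d.2 ^ 2 ≤ R ^ 2} := by
        simp only [Set.mem_ofPred_eq, hsq]
        exact pow_le_pow_left₀ hr.le h 2
      have h2 : p.1 ∈ Set.Ioc 0 R := ⟨hr, h⟩
      rw [Set.indicator_of_mem h1, Set.indicator_of_mem h2, smul_eq_mul, gaussianPDF, gaussianPDF,
        ← ENNReal.ofReal_mul (gaussianPDFReal_nonneg _ _ _), ← ENNReal.ofReal_mul hr.le,
        ← ENNReal.ofReal_mul (by positivity)]
      congr 1
      have h3 : √(2 * Real.pi * v) ≠ 0 := (Real.sqrt_pos.2 (by positivity)).ne'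
      have h4 : √(2 * Real.pi * v) ^ 2 = 2 * Real.pi * v := Real.sq_sqrt (by positivity)
      have h5 : Real.exp (-(p.1 * Real.cos p.2 - 0) ^ 2 / (2 * v)) *
          Real.exp (-(p.1 * Real.sin p.2 - 0) ^ 2 / (2 * v)) = Real.exp (-p.1 ^ 2 / (2 * v)) := by
        rw [← Real.exp_add, ← hsq]
        congr 1
        ring
      simp only [gaussianPDFReal]
      rw [← h5]
      have h6 : (√(2 * Real.pi * v))⁻¹ ^ 2 = 1 / (2 * Real.pi) / v := by
        rw [inv_pow, h4]; field_simp
      linear_combination (p.1 * (Real.exp (-(p.1 * Real.cos p.2 - 0) ^ 2 / (2 * v)) *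
          Real.exp (-(p.1 * Real.sin p.2 - 0) ^ 2 / (2 * v)))) * h6
    · have h1 : (p.1 * Real.cos p.2, p.1 * Real.sin p.2) ∉
          {d : ℝ × ℝ | d.1 ^ 2 + d.2 ^ 2 ≤ R ^ 2} := by
        simp only [Set.mem_ofPred_eq, hsq, not_le]
        exact pow_lt_pow_left₀ (not_le.1 h) hR two_ne_zero
      have h2 : p.1 ∉ Set.Ioc 0 R := fun hm => h hm.2
      rw [Set.indicator_of_notMem h1, Set.indicator_of_notMem h2, smul_zero]
  rw [setLIntegral_congr_fun polarCoord.open_target.measurableSet hpt, polarCoord_target,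
    Measure.volume_eq_prod, ← Measure.prod_restrict, lintegral_prod]
  · simp only [lintegral_const, Measure.restrict_apply MeasurableSet.univ, Set.univ_inter,
      Real.volume_Ioo]
    have hmeas : Measurable ((Set.Ioc 0 R).indicator (fun r : ℝ =>
        ENNReal.ofReal (1 / (2 * Real.pi)) *
          ENNReal.ofReal (r / v * Real.exp (-r ^ 2 / (2 * v))))) :=
      Measurable.indicator (by fun_prop) measurableSet_Ioc
    rw [lintegral_mul_const _ hmeas, lintegral_indicator measurableSet_Ioc,
      Measure.restrict_restrict measurableSet_Ioc,
      Set.inter_eq_left.2 Set.Ioc_subset_Ioi_self,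
      lintegral_const_mul _ (by fun_prop), lintegral_Ioc_rayleigh hv0 hR, mul_comm, ← mul_assoc,
      ← ENNReal.ofReal_mul (by have := Real.pi_pos; linarith)]
    rw [show (Real.pi - -Real.pi) * (1 / (2 * Real.pi)) = 1 by field_simp; ring,
      ENNReal.ofReal_one, one_mul]
  · refine Measurable.aemeasurable ?_
    exact (Measurable.indicator (by fun_prop) measurableSet_Ioc).comp measurable_fst

/-- The law of the log-energy of two independent standard Gaussian variables; it is the law of the
logarithm of a standard exponential variable. -/
noncomputable def logEnergyLaw : Measure ℝ :=
  ((gaussianReal 0 1).prod (gaussianReal 0 1)).map logMeanEnergy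

instance isProbabilityMeasure_logEnergyLaw : IsProbabilityMeasure logEnergyLaw :=
  Measure.isProbabilityMeasure_map measurable_logMeanEnergy.aemeasurable

lemma map_logMeanEnergy_sub_real_Iic {v : NNReal} (hv : v ≠ 0) (x : ℝ) :
    (((gaussianReal 0 v).prod (gaussianReal 0 v)).map
      fun d => logMeanEnergy d - Real.log v).real (Set.Iic x) = 1 - Real.exp (-Real.exp x) := by
  have hv0 : (0 : ℝ) < v := by exact_mod_cast pos_iff_ne_zero.2 hv
  rw [map_measureReal_apply (measurable_logMeanEnergy.sub_const _) measurableSet_Iic]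
  set R := √(2 * v * Real.exp x) with hR
  have hR2 : R ^ 2 = 2 * v * Real.exp x := Real.sq_sqrt (by positivity)
  have hnull : ((gaussianReal 0 v).prod (gaussianReal 0 v)) {0} = 0 := by
    have := nullSingletonClass_gaussianReal (μ := 0) hv
    rw [show ({0} : Set (ℝ × ℝ)) = {0} ×ˢ {0} by ext ⟨a, b⟩; simp, Measure.prod_prod,
      this.measure_singleton, zero_mul]
  have hae : (fun d => logMeanEnergy d - Real.log v) ⁻¹' Set.Iic x
      =ᵐ[(gaussianReal 0 v).prod (gaussianReal 0 v)]
      {d : ℝ × ℝ | d.1 ^ 2 + d.2 ^ 2 ≤ R ^ 2} := by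
    -- the logarithm has a junk value at the origin, which is a null set
    filter_upwards [measure_eq_zero_iff_ae_notMem.1 hnull] with d hd
    refine propext ?_
    change logMeanEnergy d - Real.log v ≤ x ↔ d.1 ^ 2 + d.2 ^ 2 ≤ R ^ 2
    have hpos : 0 < d.1 ^ 2 + d.2 ^ 2 := by
      rcases eq_or_ne d.1 0 with h1 | h1
      · have h2 : d.2 ≠ 0 := fun h2 => hd (Prod.ext h1 h2)
        positivity
      · positivity
    rw [logMeanEnergy, ← Real.log_div (by positivity) hv0.ne',
      Real.log_le_iff_le_exp (by positivity), hR2, div_div, div_le_iff₀ (by positivity)]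
    constructor <;> intro h <;> linarith
  rw [measureReal_congr hae, measureReal_def,
    gaussianReal_prod_sq_add_sq_le hv (Real.sqrt_nonneg _), hR2,
    ENNReal.toReal_ofReal]
  · congr 3
    field_simp
  · rw [sub_nonneg, Real.exp_le_one_iff]
    exact div_nonpos_of_nonpos_of_nonneg (by simp only [Left.neg_nonpos_iff]; positivity)
      (by positivity)

lemma logEnergyLaw_real_Iic (x : ℝ) :
    logEnergyLaw.real (Set.Iic x) = 1 - Real.exp (-Real.exp x) := by
  have h := map_logMeanEnergy_sub_real_Iic one_ne_zero x
  simpa [logEnergyLaw] using h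

/-- A change of scale of the Gaussian pair translates its log-energy. -/
lemma map_logMeanEnergy_sub_eq {v : NNReal} (hv : v ≠ 0) :
    ((gaussianReal 0 v).prod (gaussianReal 0 v)).map (fun d => logMeanEnergy d - Real.log v) =
      logEnergyLaw := by
  have : IsProbabilityMeasure (((gaussianReal 0 v).prod (gaussianReal 0 v)).map
      fun d => logMeanEnergy d - Real.log v) :=
    Measure.isProbabilityMeasure_map (measurable_logMeanEnergy.sub_const _).aemeasurable
  refine Measure.ext_of_Iic _ _ fun x => ?_
  rw [← measureReal_eq_measureReal_iff, map_logMeanEnergy_sub_real_Iic hv, logEnergyLaw_real_Iic]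

/-! ### Integrals of Gaussian processes -/

section GaussianIntegral

variable {Ω : Type*} [MeasurableSpace Ω] {μ : Measure Ω}

/-- A process with almost surely continuous paths and measurable marginals agrees, outside a null
set and for all times at once, with a process all of whose paths are continuous and all of whose
marginals are measurable. -/
lemma exists_continuous_modification {X : ℝ → Ω → ℝ} (hX : ∀ t, AEMeasurable (X t) μ)
    (hc : ∀ᵐ ω ∂μ, Continuous fun t => X t ω) :
    ∃ Y : ℝ → Ω → ℝ, (∀ t, Measurable (Y t)) ∧ (∀ ω, Continuous fun t => Y t ω) ∧
      ∀ᵐ ω ∂μ, ∀ t, X t ω = Y t ω := by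
  have hgood : ∀ᵐ ω ∂μ, (Continuous fun t => X t ω) ∧ ∀ r : ℚ, X r ω = (hX r).mk _ ω :=
    hc.and (ae_all_iff.2 fun r => (hX r).ae_eq_mk)
  obtain ⟨N, hN, hNm, hN0⟩ := exists_measurable_superset_of_null (ae_iff.1 hgood)
  have hmem (ω : Ω) (hω : ω ∉ N) :
      (Continuous fun t => X t ω) ∧ ∀ r : ℚ, X r ω = (hX r).mk _ ω := by
    by_contra h
    exact hω (hN h)
  have hYc (ω : Ω) : Continuous fun t => Nᶜ.indicator (X t) ω := by
    by_cases hω : ω ∈ N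
    · simpa [hω] using continuous_const
    · simpa [hω] using (hmem ω hω).1
  have hYr (r : ℚ) : Measurable (Nᶜ.indicator (X r)) := by
    have : Nᶜ.indicator (X r) = Nᶜ.indicator ((hX r).mk _) := by
      ext ω
      by_cases hω : ω ∈ N
      · simp [hω]
      · simp [hω, (hmem ω hω).2 r]
    rw [this]
    exact (hX r).measurable_mk.indicator hNm.compl
  refine ⟨fun t => Nᶜ.indicator (X t), fun t => ?_, hYc, ?_⟩
  · obtain ⟨x, hx, hxt⟩ := mem_closure_iff_seq_limit.1 (Rat.denseRange_cast (𝕜 := ℝ) t)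
    choose r hr using hx
    refine measurable_of_tendsto_metrizable (fun n => hYr (r n)) (tendsto_pi_nhds.2 fun ω => ?_)
    have := ((hYc ω).tendsto t).comp hxt
    refine this.congr fun n => ?_
    rw [Function.comp_apply, ← hr n]
  · filter_upwards [measure_eq_zero_iff_ae_notMem.1 hN0] with ω hω t
    simp [hω]

variable [IsProbabilityMeasure μ]

/-- An almost sure limit of centred Gaussian variables is centred Gaussian, and the variances
converge. Since the characteristic functions are the powers `exp (-vₙ / 2) ^ (u ^ 2)`, their limit
at `1` can only vanish if the limit is discontinuous at `0`. -/
lemma exists_hasLaw_gaussianReal_of_ae_tendsto {X : ℕ → Ω → ℝ} {Y : Ω → ℝ} {v : ℕ → NNReal}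
    (hX : ∀ n, HasLaw (X n) (gaussianReal 0 (v n)) μ)
    (hlim : ∀ᵐ ω ∂μ, Tendsto (fun n => X n ω) atTop (𝓝 (Y ω))) :
    ∃ w, HasLaw Y (gaussianReal 0 w) μ ∧ Tendsto v atTop (𝓝 w) := by
  have hY : AEMeasurable Y μ :=
    aemeasurable_of_tendsto_metrizable_ae atTop (fun n => (hX n).aemeasurable) hlim
  have hprob : IsProbabilityMeasure (μ.map Y) := Measure.isProbabilityMeasure_map hY
  have hD := tendstoInDistribution_of_ae_tendsto (fun n => (hX n).aemeasurable) hY hlim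
  have hφ (u : ℝ) : Tendsto (fun n => ((Real.exp (-(v n : ℝ) / 2) ^ (u ^ 2) : ℝ) : ℂ)) atTop
      (𝓝 (charFun (μ.map Y) u)) := by
    refine (ProbabilityMeasure.tendsto_iff_tendsto_charFun.1 hD.tendsto u).congr fun n => ?_
    change charFun (μ.map (X n)) u = _
    rw [(hX n).map_eq, charFun_gaussianReal, ← Real.exp_mul, Complex.ofReal_exp]
    congr 1
    push_cast
    ring
  have hre (u : ℝ) : Tendsto (fun n => Real.exp (-(v n : ℝ) / 2) ^ (u ^ 2)) atTop
      (𝓝 (charFun (μ.map Y) u).re) := by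
    simpa using! (Complex.continuous_re.tendsto _).comp (hφ u)
  set ρ := (charFun (μ.map Y) 1).re with hρ
  have h1 : Tendsto (fun n => Real.exp (-(v n : ℝ) / 2)) atTop (𝓝 ρ) := by
    simpa using hre 1
  have hρ0 : 0 ≤ ρ := ge_of_tendsto' h1 fun n => (Real.exp_pos _).le
  have hρpos : 0 < ρ := by
    refine lt_of_le_of_ne hρ0 fun h0 => ?_
    have hz (u : ℝ) (hu : u ≠ 0) : (charFun (μ.map Y) u).re = 0 := by
      have h2 := h1.rpow_const (p := u ^ 2) (Or.inr (sq_nonneg u))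
      rw [← h0, Real.zero_rpow (pow_ne_zero 2 hu)] at h2
      exact tendsto_nhds_unique (hre u) h2
    have hc : Tendsto (fun u => (charFun (μ.map Y) u).re) (𝓝[≠] 0) (𝓝 1) := by
      have hcont : Continuous fun u => (charFun (μ.map Y) u).re :=
        Complex.continuous_re.comp continuous_charFun
      have := hcont.tendsto 0
      simp only [charFun_zero, probReal_univ, Complex.ofReal_one, Complex.one_re] at this
      exact this.mono_left nhdsWithin_le_nhds
    have hc0 : Tendsto (fun u => (charFun (μ.map Y) u).re) (𝓝[≠] 0) (𝓝 0) :=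
      tendsto_const_nhds.congr' (by
        filter_upwards [self_mem_nhdsWithin] with u hu using (hz u hu).symm)
    exact one_ne_zero (tendsto_nhds_unique hc hc0)
  have hv : Tendsto (fun n => (v n : ℝ)) atTop (𝓝 (-2 * Real.log ρ)) := by
    refine (((Real.continuousAt_log hρpos.ne').tendsto.comp h1).const_mul (-2)).congr fun n => ?_
    simp only [Function.comp, Real.log_exp]
    ring
  have hw0 : 0 ≤ -2 * Real.log ρ := ge_of_tendsto' hv fun n => NNReal.coe_nonneg _
  obtain ⟨w, hw⟩ : ∃ w : NNReal, (w : ℝ) = -2 * Real.log ρ := ⟨⟨_, hw0⟩, rfl⟩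
  rw [← hw] at hv
  refine ⟨w, ⟨hY, Measure.ext_of_charFun (funext fun u => ?_)⟩,
    NNReal.tendsto_coe.1 hv⟩
  have h3 : Tendsto (fun n => charFun (gaussianReal 0 (v n)) u) atTop
      (𝓝 (charFun (gaussianReal 0 w) u)) := by
    simp only [charFun_gaussianReal]
    refine (Complex.continuous_exp.tendsto _).comp (Tendsto.sub tendsto_const_nhds ?_)
    exact (((Complex.continuous_ofReal.tendsto _).comp hv).mul_const _).div_const _
  have h4 : Tendsto (fun n => charFun (gaussianReal 0 (v n)) u) atTop
      (𝓝 (charFun (μ.map Y) u)) := by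
    refine (ProbabilityMeasure.tendsto_iff_tendsto_charFun.1 hD.tendsto u).congr fun n => ?_
    change charFun (μ.map (X n)) u = _
    rw [(hX n).map_eq]
  exact tendsto_nhds_unique h4 h3

/-- Tonelli's theorem for the paths of a process: a bound on the first absolute moments gives
almost sure integrability against a weight. -/
lemma ae_integrable_mul_of_integral_abs_le {X : ℝ → Ω → ℝ} (hX : ∀ t, Integrable (X t) μ)
    (hc : ∀ᵐ ω ∂μ, Continuous fun t => X t ω) {ψ b : ℝ → ℝ}
    (hψ : AEStronglyMeasurable ψ volume) (hb : ∀ t, ∫ ω, |X t ω| ∂μ ≤ b t)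
    (hbψ : Integrable fun t => b t * ψ t) :
    ∀ᵐ ω ∂μ, Integrable fun t => X t ω * ψ t := by
  obtain ⟨Y, hYm, hYc, hXY⟩ := exists_continuous_modification (fun t => (hX t).aemeasurable) hc
  have hXY' (t : ℝ) : X t =ᵐ[μ] Y t := hXY.mono fun ω h => h t
  have hm : AEStronglyMeasurable (fun p : ℝ × Ω => Y p.1 p.2 * ψ p.1) (volume.prod μ) :=
    (measurable_uncurry_of_continuous_of_measurable hYc hYm).aestronglyMeasurable.mul hψ.comp_fst
  have hint : Integrable (fun p : ℝ × Ω => Y p.1 p.2 * ψ p.1) (volume.prod μ) := by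
    refine (integrable_prod_iff hm).2 ⟨ae_of_all _ fun t => ?_, ?_⟩
    · exact ((hX t).congr (hXY' t)).mul_const (ψ t)
    · refine hbψ.mono hm.norm.integral_prod_right' (ae_of_all _ fun t => ?_)
      simp only [norm_mul, integral_mul_const]
      rw [norm_norm (ψ t)]
      have h1 : ∫ ω, ‖Y t ω‖ ∂μ ≤ b t := by
        refine le_trans (le_of_eq ?_) (hb t)
        exact integral_congr_ae ((hXY' t).mono fun ω h => by simp [h])
      gcongr
      rw [Real.norm_of_nonneg (integral_nonneg fun _ => norm_nonneg _)]
      exact h1.trans (le_abs_self _)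
  filter_upwards [hint.prod_left_ae, hXY] with ω h1 h2
  simpa only [h2] using h1

lemma hasLaw_fun_sum_mul_of_isGaussianProcess {X : ℝ → Ω → ℝ} (hX : IsGaussianProcess X μ)
    (h0 : ∀ t, ∫ ω, X t ω ∂μ = 0) (I : Finset ℝ) (c : ℝ → ℝ) :
    HasLaw (fun ω => ∑ y ∈ I, c y * X y ω)
      (gaussianReal 0 (∑ y ∈ I, ∑ z ∈ I, c z * (c y * cov[X y, X z; μ])).toNNReal) μ := by
  have hG := (hX.smul c).hasGaussianLaw_fun_sum (I := I)
  simp only [smul_eq_mul] at hG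
  refine ⟨hG.aemeasurable, ?_⟩
  have hL2 (t : ℝ) : MemLp (fun ω => c t * X t ω) 2 μ :=
    (hX.hasGaussianLaw_eval t).memLp_two.const_mul (c t)
  rw [hG.map_eq_gaussianReal, integral_finsetSum _ fun y _ =>
    ((hX.hasGaussianLaw_eval y).integrable.const_mul (c y)), variance_fun_sum' fun y _ => hL2 y]
  simp only [integral_const_mul, h0, mul_zero, Finset.sum_const_zero, covariance_const_mul_left,
    covariance_const_mul_right]

lemma integral_comp_simpleFunc_mul {ν : Measure ℝ} {ψ : ℝ → ℝ} (hψ : Integrable ψ ν)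
    (f : ℝ → ℝ) (π : SimpleFunc ℝ ℝ) :
    ∫ t, f (π t) * ψ t ∂ν = ∑ y ∈ π.range, (∫ t in π ⁻¹' {y}, ψ t ∂ν) * f y := by
  have h (t : ℝ) : f (π t) * ψ t = ∑ y ∈ π.range, (π ⁻¹' {y}).indicator (fun t => f y * ψ t) t := by
    rw [Finset.sum_eq_single (π t)]
    · simp
    · intro y _ hy
      simp [hy.symm]
    · intro h
      exact absurd (SimpleFunc.mem_range_self π t) h
  simp_rw [h]
  rw [integral_finsetSum _ fun y _ =>
    (hψ.const_mul (f y)).indicator (π.measurableSet_preimage {y})]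
  refine Finset.sum_congr rfl fun y _ => ?_
  rw [integral_indicator (π.measurableSet_preimage {y}), integral_const_mul, mul_comm]

/-- Riemann sums of a continuous path over a bounded window, against an integrable weight. -/
lemma tendsto_setIntegral_comp_approxOn {f ψ : ℝ → ℝ} (hf : Continuous f) (hψ : Integrable ψ)
    {R : ℝ} (hR : (0 : ℝ) ∈ Set.Icc (-R) R) :
    Tendsto (fun n => ∫ t in Set.Icc (-R) R,
      f (SimpleFunc.approxOn id measurable_id (Set.Icc (-R) R) 0 hR n t) * ψ t) atTop
      (𝓝 (∫ t in Set.Icc (-R) R, f t * ψ t)) := by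
  obtain ⟨M, hM⟩ := (isCompact_Icc (a := -R) (b := R)).exists_bound_of_continuousOn hf.continuousOn
  refine tendsto_integral_of_dominated_convergence (fun t => M * ‖ψ t‖) (fun n => ?_)
    (hψ.norm.const_mul M).integrableOn (fun n => ae_of_all _ fun t => ?_) ?_
  · exact ((hf.measurable.comp (SimpleFunc.measurable _)).aestronglyMeasurable).mul
      hψ.aestronglyMeasurable.restrict
  · rw [norm_mul]
    gcongr
    exact hM _ (SimpleFunc.approxOn_mem measurable_id hR n t)
  · filter_upwards [ae_restrict_mem measurableSet_Icc] with t ht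
    exact ((hf.tendsto t).comp (SimpleFunc.tendsto_approxOn measurable_id hR
      (subset_closure ht))).mul_const _

/-- Integrals against a common weight of two centred Gaussian processes with continuous paths and
equal covariances have the same centred Gaussian law. -/
lemma exists_hasLaw_gaussianReal_integral {X X' : ℝ → Ω → ℝ} {ψ : ℝ → ℝ}
    (hX : IsGaussianProcess X μ) (hX' : IsGaussianProcess X' μ)
    (h0 : ∀ t, ∫ ω, X t ω ∂μ = 0) (h0' : ∀ t, ∫ ω, X' t ω ∂μ = 0)
    (hc : ∀ᵐ ω ∂μ, Continuous fun t => X t ω) (hc' : ∀ᵐ ω ∂μ, Continuous fun t => X' t ω)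
    (hcov : ∀ s t, cov[X s, X t; μ] = cov[X' s, X' t; μ]) (hψ : Integrable ψ)
    (hi : ∀ᵐ ω ∂μ, Integrable fun t => X t ω * ψ t)
    (hi' : ∀ᵐ ω ∂μ, Integrable fun t => X' t ω * ψ t) :
    ∃ w, HasLaw (fun ω => ∫ t, X t ω * ψ t) (gaussianReal 0 w) μ ∧
      HasLaw (fun ω => ∫ t, X' t ω * ψ t) (gaussianReal 0 w) μ := by
  -- on a bounded window, the integrals are limits of Riemann sums with a common net, whose
  -- variances depend on the covariance only
  have hbdd (R : ℕ) : ∃ w,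
      HasLaw (fun ω => ∫ t in Set.Icc (-(R : ℝ)) R, X t ω * ψ t) (gaussianReal 0 w) μ ∧
      HasLaw (fun ω => ∫ t in Set.Icc (-(R : ℝ)) R, X' t ω * ψ t) (gaussianReal 0 w) μ := by
    have hR : (0 : ℝ) ∈ Set.Icc (-(R : ℝ)) R := by simp
    let π := SimpleFunc.approxOn id measurable_id (Set.Icc (-(R : ℝ)) R) 0 hR
    let c (n : ℕ) (y : ℝ) : ℝ := ∫ t in π n ⁻¹' {y}, ψ t ∂volume.restrict (Set.Icc (-(R : ℝ)) R)
    have hs (f : ℝ → ℝ) (n : ℕ) := integral_comp_simpleFunc_mul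
      (ν := volume.restrict (Set.Icc (-(R : ℝ)) R)) hψ.restrict f (π n)
    obtain ⟨w, hw, hwlim⟩ := exists_hasLaw_gaussianReal_of_ae_tendsto
      (Y := fun ω => ∫ t in Set.Icc (-(R : ℝ)) R, X t ω * ψ t)
      (fun n => hasLaw_fun_sum_mul_of_isGaussianProcess hX h0 (π n).range (c n)) (by
        filter_upwards [hc] with ω hω
        exact (tendsto_setIntegral_comp_approxOn hω hψ hR).congr (hs fun t => X t ω))
    obtain ⟨w', hw', hwlim'⟩ := exists_hasLaw_gaussianReal_of_ae_tendsto
      (Y := fun ω => ∫ t in Set.Icc (-(R : ℝ)) R, X' t ω * ψ t)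
      (fun n => hasLaw_fun_sum_mul_of_isGaussianProcess hX' h0' (π n).range (c n)) (by
        filter_upwards [hc'] with ω hω
        exact (tendsto_setIntegral_comp_approxOn hω hψ hR).congr (hs fun t => X' t ω))
    simp only [hcov] at hwlim
    obtain rfl := tendsto_nhds_unique hwlim hwlim'
    exact ⟨w, hw, hw'⟩
  choose v hv hv' using hbdd
  -- letting the window grow
  have hcover : AECover volume atTop fun R : ℕ => Set.Icc (-(R : ℝ)) R :=
    aecover_Icc (tendsto_neg_atTop_atBot.comp tendsto_natCast_atTop_atTop)
      tendsto_natCast_atTop_atTop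
  obtain ⟨w, hw, hwlim⟩ := exists_hasLaw_gaussianReal_of_ae_tendsto
    (Y := fun ω => ∫ t, X t ω * ψ t) hv (by
      filter_upwards [hi] with ω hω using hcover.integral_tendsto_of_countably_generated hω)
  obtain ⟨w', hw', hwlim'⟩ := exists_hasLaw_gaussianReal_of_ae_tendsto
    (Y := fun ω => ∫ t, X' t ω * ψ t) hv' (by
      filter_upwards [hi'] with ω hω using hcover.integral_tendsto_of_countably_generated hω)
  obtain rfl := tendsto_nhds_unique hwlim hwlim'
  exact ⟨w, hw, hw'⟩

end GaussianIntegral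

/-! ### Wavelet coefficients of fractional Brownian motion -/

/-- A change of variables turns a wavelet coefficient into an integral of the path at scale
`2 ^ (-j)` around the position `k`. -/
lemma waveletCoeff_eq {Ω : Type*} (B : ℝ → Ω → ℝ) (ψ : ℝ → ℝ) (j k : ℤ) (ω : Ω) :
    waveletCoeff B ψ j k ω = (2 : ℝ) ^ (-(j : ℝ) / 2) *
      ∫ s, B (k + (2 : ℝ) ^ (-j) * s) ω * ψ s := by
  have ha : (0 : ℝ) < 2 ^ (-j) := by positivity
  have h1 := integral_add_left_eq_self (μ := (volume : Measure ℝ))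
    (fun t => B t ω * waveletAtom ψ j k t) (k : ℝ)
  have h2 := Measure.integral_comp_mul_left
    (fun t => B (k + t) ω * waveletAtom ψ j k (k + t)) ((2 : ℝ) ^ (-j))
  rw [waveletCoeff, ← h1]
  rw [zpow_neg, inv_inv, abs_of_pos (by positivity), smul_eq_mul, ← zpow_neg] at h2
  have h3 : ∫ t, B (k + t) ω * waveletAtom ψ j k (k + t) = (2 : ℝ) ^ (-j) *
      ∫ s, B (k + (2 : ℝ) ^ (-j) * s) ω * waveletAtom ψ j k (k + (2 : ℝ) ^ (-j) * s) := by
    rw [h2, ← mul_assoc, ← zpow_add₀ two_ne_zero]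
    simp
  rw [h3, ← integral_const_mul, ← integral_const_mul]
  refine integral_congr_ae (ae_of_all _ fun s => ?_)
  have h4 : (2 : ℝ) ^ j * ((k : ℝ) + (2 : ℝ) ^ (-j) * s - k) = s := by
    rw [add_sub_cancel_left, ← mul_assoc, ← zpow_add₀ two_ne_zero]
    simp
  have h5 : (2 : ℝ) ^ (-j) * (2 : ℝ) ^ ((j : ℝ) / 2) = (2 : ℝ) ^ (-(j : ℝ) / 2) := by
    rw [← Real.rpow_intCast, ← Real.rpow_add two_pos]
    congr 1
    push_cast
    ring
  simp only [waveletAtom, h4]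
  rw [← h5]
  ring

section Wavelet

variable {Ω : Type*} [MeasurableSpace Ω] {μ : Measure Ω}
  {H : ℝ} {B : ℝ → Ω → ℝ}

lemma IsFractionalBrownianMotion.memLp_two (hB : IsFractionalBrownianMotion H B μ) (t : ℝ) :
    MemLp (B t) 2 μ := (hB.gaussian.hasGaussianLaw_eval t).memLp_two

lemma IsFractionalBrownianMotion.integrable (hB : IsFractionalBrownianMotion H B μ) (t : ℝ) :
    Integrable (B t) μ := (hB.gaussian.hasGaussianLaw_eval t).integrable

/-- Stationary increments and self-similarity at the level of covariances: the rescaled increments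
of a fractional Brownian motion form a fractional Brownian motion. -/
lemma IsFractionalBrownianMotion.increments (hB : IsFractionalBrownianMotion H B μ)
    (hH : 0 < H) {a : ℝ} (ha : 0 < a) (b : ℝ) :
    IsFractionalBrownianMotion H (fun t ω => B (b + a * t) ω - B b ω) μ ∧
      variance (fun ω => B (b + a * 1) ω - B b ω) μ = a ^ (2 * H) * variance (B 1) μ := by
  have hprob : IsProbabilityMeasure μ := hB.gaussian.isProbabilityMeasure
  have hcov (s t : ℝ) : cov[fun ω => B (b + a * s) ω - B b ω, fun ω => B (b + a * t) ω - B b ω; μ] =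
      a ^ (2 * H) * variance (B 1) μ / 2 * (|s| ^ (2 * H) + |t| ^ (2 * H) - |s - t| ^ (2 * H)) := by
    have hmul (x : ℝ) : |a * x| ^ (2 * H) = a ^ (2 * H) * |x| ^ (2 * H) := by
      rw [abs_mul, abs_of_pos ha, Real.mul_rpow ha.le (abs_nonneg x)]
    rw [covariance_fun_sub_fun_sub (hB.memLp_two _) (hB.memLp_two _) (hB.memLp_two _)
      (hB.memLp_two _)]
    simp only [hB.covariance]
    rw [show b + a * s - (b + a * t) = a * (s - t) by ring, add_sub_cancel_left,
      show b - (b + a * t) = -(a * t) by ring, abs_neg, sub_self, abs_zero,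
      Real.zero_rpow (by positivity), hmul, hmul, hmul]
    ring
  have hvar : variance (fun ω => B (b + a * 1) ω - B b ω) μ = a ^ (2 * H) * variance (B 1) μ := by
    rw [← covariance_self (X := fun ω => B (b + a * 1) ω - B b ω)
      ((hB.memLp_two _).sub (hB.memLp_two _)).aemeasurable, hcov]
    simp only [abs_one, Real.one_rpow, sub_self, abs_zero,
      Real.zero_rpow (by positivity : 2 * H ≠ 0)]
    ring
  refine ⟨⟨?_, fun t => ?_, fun s t => ?_, ?_⟩, hvar⟩
  · have h := (hB.gaussian.shift b).comp_right (fun t : ℝ => a * t)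
    exact h
  · rw [integral_sub (hB.integrable _) (hB.integrable _), hB.centered, hB.centered, sub_zero]
  · rw [hcov, hvar]
  · filter_upwards [hB.continuous_paths] with ω hω
    exact (hω.comp (by fun_prop : Continuous fun t : ℝ => b + a * t)).sub continuous_const

lemma IsFractionalBrownianMotion.const_mul (hB : IsFractionalBrownianMotion H B μ) (c : ℝ) :
    IsFractionalBrownianMotion H (fun t ω => c * B t ω) μ where
  gaussian := hB.gaussian.smul fun _ => c
  centered t := by rw [integral_const_mul, hB.centered, mul_zero]
  covariance s t := by
    rw [covariance_const_mul_left, covariance_const_mul_right, hB.covariance, variance_const_mul]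
    ring
  continuous_paths := by
    filter_upwards [hB.continuous_paths] with ω hω using continuous_const.mul hω

lemma IsFractionalBrownianMotion.integral_abs_le (hB : IsFractionalBrownianMotion H B μ)
    (hH : 0 < H) (t : ℝ) : ∫ ω, |B t ω| ∂μ ≤ √(variance (B 1) μ) * |t| ^ H := by
  have hprob : IsProbabilityMeasure μ := hB.gaussian.isProbabilityMeasure
  have h1 := variance_nonneg (fun ω => |B t ω|) μ
  rw [variance_eq_sub (X := fun ω => |B t ω|) (hB.memLp_two t).abs, sub_nonneg] at h1
  have h2 : μ[(fun ω => |B t ω|) ^ 2] = variance (B t) μ := by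
    rw [variance_of_integral_eq_zero (hB.memLp_two t).aemeasurable (hB.centered t)]
    simp [Pi.pow_apply]
  have h3 : variance (B t) μ = (√(variance (B 1) μ) * |t| ^ H) ^ 2 := by
    rw [← covariance_self (hB.memLp_two t).aemeasurable, hB.covariance, mul_pow,
      Real.sq_sqrt (variance_nonneg _ _), sub_self, abs_zero, Real.zero_rpow (by positivity),
      ← Real.rpow_natCast (|t| ^ H), ← Real.rpow_mul (abs_nonneg t)]
    rw [show H * ((2 : ℕ) : ℝ) = 2 * H by push_cast; ring]
    ring
  rw [h2, h3] at h1
  exact (abs_le_of_sq_le_sq' h1 (by positivity)).2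

lemma IsFractionalBrownianMotion.ae_integrable_mul (hB : IsFractionalBrownianMotion H B μ)
    (hH : 0 < H) {ψ : ℝ → ℝ} (hψ : Integrable ψ) (hψH : Integrable fun t : ℝ => |t| ^ H * ψ t) :
    ∀ᵐ ω ∂μ, Integrable fun t => B t ω * ψ t := by
  have hprob : IsProbabilityMeasure μ := hB.gaussian.isProbabilityMeasure
  refine ae_integrable_mul_of_integral_abs_le hB.integrable hB.continuous_paths
    hψ.aestronglyMeasurable (hB.integral_abs_le hH) ?_
  simpa only [mul_assoc] using hψH.const_mul _

lemma IsFractionalBrownianMotion.exists_hasLaw_gaussianReal_integral {B' : ℝ → Ω → ℝ}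
    (hB : IsFractionalBrownianMotion H B μ) (hB' : IsFractionalBrownianMotion H B' μ)
    (hv : variance (B 1) μ = variance (B' 1) μ) (hH : 0 < H) {ψ : ℝ → ℝ} (hψ : Integrable ψ)
    (hψH : Integrable fun t : ℝ => |t| ^ H * ψ t) :
    ∃ w, HasLaw (fun ω => ∫ t, B t ω * ψ t) (gaussianReal 0 w) μ ∧
      HasLaw (fun ω => ∫ t, B' t ω * ψ t) (gaussianReal 0 w) μ := by
  have hprob : IsProbabilityMeasure μ := hB.gaussian.isProbabilityMeasure
  exact _root_.exists_hasLaw_gaussianReal_integral hB.gaussian hB'.gaussian hB.centered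
    hB'.centered hB.continuous_paths hB'.continuous_paths
    (fun s t => by rw [hB.covariance, hB'.covariance, hv]) hψ
    (hB.ae_integrable_mul hH hψ hψH) (hB'.ae_integrable_mul hH hψ hψH)

/-- The law of a wavelet coefficient depends on the level only, through a power law. -/
lemma hasLaw_waveletCoeff (hB : IsFractionalBrownianMotion H B μ) (hH : 0 < H)
    {ψ : ℝ → ℝ} (hψ : Integrable ψ) (hψH : Integrable fun t : ℝ => |t| ^ H * ψ t)
    (hψ0 : ∫ t, ψ t = 0) (j k : ℤ) :
    HasLaw (waveletCoeff B ψ j k) (gaussianReal 0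
      ((2 : ℝ) ^ (-(j : ℝ) * (2 * H + 1)) * variance (waveletCoeff B ψ 0 0) μ).toNNReal) μ := by
  have hprob : IsProbabilityMeasure μ := hB.gaussian.isProbabilityMeasure
  set a : ℝ := (2 : ℝ) ^ (-j) with ha
  have ha0 : 0 < a := by positivity
  obtain ⟨hA, hAv⟩ := hB.increments hH ha0 k
  have hC := hB.const_mul (a ^ H)
  have haH : (a ^ H) ^ 2 = a ^ (2 * H) := by
    rw [← Real.rpow_natCast, ← Real.rpow_mul ha0.le]
    congr 1
    push_cast
    ring
  obtain ⟨w, hw, hw'⟩ := hA.exists_hasLaw_gaussianReal_integral hC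
    (by rw [hAv, variance_const_mul, haH]) hH hψ hψH
  have h00 : (fun ω => ∫ t, a ^ H * B t ω * ψ t) = fun ω => a ^ H * waveletCoeff B ψ 0 0 ω := by
    ext ω
    simp only [mul_assoc]
    rw [integral_const_mul, waveletCoeff_eq]
    simp
  rw [h00] at hw'
  have hwv : (w : ℝ) = a ^ (2 * H) * variance (waveletCoeff B ψ 0 0) μ := by
    have h := hw'.variance_eq
    rw [variance_const_mul, haH, variance_id_gaussianReal] at h
    exact h.symm
  -- the vanishing moment of `ψ` lets the path be centred at the position `k`
  have hae : waveletCoeff B ψ j k =ᵐ[μ] fun ω =>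
      (2 : ℝ) ^ (-(j : ℝ) / 2) * ∫ t, (B (k + a * t) ω - B k ω) * ψ t := by
    filter_upwards [hA.ae_integrable_mul hH hψ hψH] with ω hω
    rw [waveletCoeff_eq]
    congr 1
    have h1 : ∫ t, ((B (k + a * t) ω - B k ω) * ψ t + B k ω * ψ t) =
        (∫ t, (B (k + a * t) ω - B k ω) * ψ t) + ∫ t, B k ω * ψ t :=
      integral_add hω (hψ.const_mul _)
    rw [integral_const_mul, hψ0, mul_zero, add_zero] at h1
    rw [← h1]
    refine integral_congr_ae (ae_of_all _ fun t => ?_)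
    simp only [ha]
    ring
  have hlaw := (gaussianReal_const_mul hw ((2 : ℝ) ^ (-(j : ℝ) / 2))).congr hae
  convert! hlaw using 2
  · simp
  · ext
    rw [Real.coe_toNNReal _ (mul_nonneg (by positivity) (variance_nonneg _ _))]
    push_cast
    rw [hwv, ← mul_assoc, ← Real.rpow_natCast, ← Real.rpow_mul two_pos.le, ha,
      ← Real.rpow_intCast, ← Real.rpow_mul two_pos.le, ← Real.rpow_add two_pos]
    congr 2
    push_cast
    ring

end Wavelet

/-! ### Random positions and independence of blocks -/

section RandomIndex

variable {Ω : Type*} [MeasurableSpace Ω] {μ : Measure Ω}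

/-- Evaluating a countable family at an independent random index does not change the common law
of the members of the family; only indices that are attained with positive probability matter. -/
lemma hasLaw_randomIndex [IsProbabilityMeasure μ] {ι E : Type*} [Countable ι] [MeasurableSpace ι]
    [MeasurableSingletonClass ι] [MeasurableSpace E] {ν : Measure E} {f : Ω → ι}
    (hf : Measurable f) {X : ι → Ω → E} (hX : ∀ i, AEMeasurable (X i) μ)
    (hfX : ∀ i, IndepFun f (X i) μ) (hν : ∀ i, μ (f ⁻¹' {i}) ≠ 0 → μ.map (X i) = ν) :
    HasLaw (fun ω => X (f ω) ω) ν μ := by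
  have hm : Measurable fun ω => (hX (f ω)).mk (X (f ω)) ω := by
    have h : Measurable fun p : Ω × ι => (hX p.2).mk (X p.2) p.1 :=
      measurable_from_prod_countable_left fun i => (hX i).measurable_mk
    exact h.comp (measurable_id.prodMk hf)
  have hae : (fun ω => X (f ω) ω) =ᵐ[μ] fun ω => (hX (f ω)).mk (X (f ω)) ω := by
    filter_upwards [ae_all_iff.2 fun i => (hX i).ae_eq_mk] with ω hω using hω _
  have ham : AEMeasurable (fun ω => X (f ω) ω) μ := ⟨_, hm, hae⟩
  have sum_univ : ∑' i, μ (f ⁻¹' {i}) = 1 := by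
    rw [← tsum_univ (f := fun i => μ (f ⁻¹' {i})),
      tsum_measure_preimage_singleton (Set.to_countable _) fun i _ => hf (.singleton i)]
    simp
  refine ⟨ham, ?_⟩
  ext A hA
  rw [Measure.map_congr hae, Measure.map_apply hm hA]
  set S := (fun ω => (hX (f ω)).mk (X (f ω)) ω) ⁻¹' A
  have key : ∀ i, μ.restrict S (f ⁻¹' {i}) = μ (f ⁻¹' {i}) * ν A := by
    intro i
    rw [Measure.restrict_apply (hf (.singleton i))]
    by_cases h0 : μ (f ⁻¹' {i}) = 0
    · rw [h0, zero_mul]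
      exact measure_mono_null Set.inter_subset_left h0
    · rw [← hν i h0, Measure.map_apply_of_aemeasurable (hX i) hA,
        ← (hfX i).measure_inter_preimage_eq_mul _ _ (.singleton i) hA]
      apply measure_congr
      filter_upwards [(hX i).ae_eq_mk] with ω hω
      refine propext ?_
      change (f ω = i ∧ (hX (f ω)).mk (X (f ω)) ω ∈ A) ↔ (f ω = i ∧ X i ω ∈ A)
      constructor
      · rintro ⟨rfl, h⟩
        exact ⟨rfl, by rwa [hω]⟩
      · rintro ⟨rfl, h⟩
        exact ⟨rfl, by rwa [← hω]⟩
  calc μ S = μ.restrict S (f ⁻¹' Set.univ) := by simp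
    _ = ∑' i : (Set.univ : Set ι), μ.restrict S (f ⁻¹' {↑i}) :=
        (tsum_measure_preimage_singleton (Set.to_countable _) fun i _ => hf (.singleton i)).symm
    _ = ∑' i, μ.restrict S (f ⁻¹' {i}) := tsum_univ (f := fun i => μ.restrict S (f ⁻¹' {i}))
    _ = ν A := by simp_rw [key, ENNReal.tsum_mul_right, sum_univ, one_mul]

/-- Two coefficients of one level, observed at independent random positions that are almost surely
far enough apart, are independent with the common law of the coefficients of that level. -/
lemma hasLaw_sampledPair [IsProbabilityMeasure μ] {B : ℝ → Ω → ℝ} {ψ : ℝ → ℝ} {j : ℤ} {q : ℝ}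
    {ν : Measure ℝ} (hν : ∀ k, HasLaw (waveletCoeff B ψ j k) ν μ)
    (hq : ∀ k₁ k₂ : ℤ, q < |(k₁ : ℝ) - (k₂ : ℝ)| →
      IndepFun (waveletCoeff B ψ j k₁) (waveletCoeff B ψ j k₂) μ)
    {K : Fin 2 → Ω → ℤ} (hK : ∀ e, Measurable (K e))
    (hKq : ∀ᵐ ω ∂μ, q < |(K 0 ω : ℝ) - (K 1 ω : ℝ)|)
    (hKB : IndepFun (fun ω (e : Fin 2) => K e ω)
      (fun ω (p : ℤ × ℤ) => waveletCoeff B ψ p.1 p.2 ω) μ) :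
    HasLaw (sampledPair B ψ j K) (ν.prod ν) μ := by
  refine hasLaw_randomIndex (f := fun ω => (K 0 ω, K 1 ω))
    (X := fun (p : ℤ × ℤ) ω => (waveletCoeff B ψ j p.1 ω, waveletCoeff B ψ j p.2 ω))
    ((hK 0).prodMk (hK 1))
    (fun p => (hν p.1).aemeasurable.prodMk (hν p.2).aemeasurable) (fun p => ?_) (fun p hp => ?_)
  · exact hKB.comp (φ := fun k : Fin 2 → ℤ => (k 0, k 1))
      (ψ := fun d : ℤ × ℤ → ℝ => (d (j, p.1), d (j, p.2))) (by fun_prop) (by fun_prop)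
  · by_cases hgap : q < |(p.1 : ℝ) - (p.2 : ℝ)|
    · exact ((hq _ _ hgap).hasLaw_prod (hν _) (hν _)).map_eq
    · refine absurd (measure_mono_null (fun ω hω => ?_) (ae_iff.1 hKq)) hp
      have h : (K 0 ω, K 1 ω) = p := hω
      rw [← h] at hgap
      exact hgap

/-- Splitting an independent family into blocks gives an independent family of blocks. -/
lemma iIndepFun_curry [IsProbabilityMeasure μ] {ι κ E : Type*} [Countable ι] [Countable κ]
    [MeasurableSpace E] {X : ι × κ → Ω → E} (hX : ∀ p, AEMeasurable (X p) μ)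
    (h : iIndepFun X μ) : iIndepFun (fun i ω k => X (i, k) ω) μ := by
  have hp : ∀ p, IsProbabilityMeasure (μ.map (X p)) := fun p =>
    Measure.isProbabilityMeasure_map (hX p)
  rw [iIndepFun_iff_map_fun_eq_infinitePi_map₀'
    fun i => aemeasurable_pi_iff.2 fun k => hX (i, k)]
  have hblock : ∀ i, μ.map (fun ω k => X (i, k) ω)
      = Measure.infinitePi fun k => μ.map (X (i, k)) := fun i =>
    (h.precomp (g := fun k => (i, k)) (Prod.mk_right_injective i)).map_fun_eq_infinitePi_map₀'
      fun k => hX (i, k)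
  simp_rw [hblock]
  rw [← Measure.infinitePi_map_curry fun i k => μ.map (X (i, k)),
    ← h.map_fun_eq_infinitePi_map₀' hX, AEMeasurable.map_map_of_aemeasurable
      (MeasurableEquiv.measurable _).aemeasurable (aemeasurable_pi_iff.2 hX)]
  rfl

end RandomIndex

/-! ### Linear combinations of independent sample medians -/

section Blocks

variable {Ω : Type*} [MeasurableSpace Ω] {μ : Measure Ω}

lemma iIndepFun_sampleMedian_block [IsProbabilityMeasure μ] {m N : ℕ} {Y : Fin m × Fin N → Ω → ℝ}
    (hY : ∀ p, AEMeasurable (Y p) μ) (hind : iIndepFun Y μ) :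
    iIndepFun (fun l ω => sampleMedian fun i => Y (l, i) ω) μ :=
  (iIndepFun_curry hY hind).comp (fun _ => sampleMedian) fun _ => measurable_sampleMedian

variable {γ : Measure ℝ}

lemma hasLaw_block {m N : ℕ} {Y : Fin m × Fin N → Ω → ℝ} (hY : ∀ p, HasLaw (Y p) γ μ)
    (hind : iIndepFun Y μ) (l : Fin m) :
    HasLaw (fun ω (i : Fin N) => Y (l, i) ω) (Measure.pi fun _ => γ) μ :=
  (hind.precomp (g := fun i => (l, i)) (Prod.mk_right_injective l)).hasLaw_pi fun i => hY (l, i)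

lemma hasLaw_sampleMedian_block {m N : ℕ} {Y : Fin m × Fin N → Ω → ℝ}
    (hY : ∀ p, HasLaw (Y p) γ μ) (hind : iIndepFun Y μ) (l : Fin m) :
    HasLaw (fun ω => sampleMedian fun i => Y (l, i) ω)
      ((Measure.pi fun _ : Fin N => γ).map sampleMedian) μ := by
  have h : HasLaw (fun x : Fin N → ℝ => sampleMedian x)
      ((Measure.pi fun _ : Fin N => γ).map sampleMedian) (Measure.pi fun _ : Fin N => γ) :=
    { aemeasurable := measurable_sampleMedian.aemeasurable, map_eq := rfl }
  exact h.comp (hasLaw_block hY hind l)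

lemma hasLaw_rescaled_sampleMedian_block {m N : ℕ} {Y : Fin m × Fin N → Ω → ℝ}
    (hY : ∀ p, HasLaw (Y p) γ μ) (hind : iIndepFun Y μ) (l : Fin m) :
    HasLaw (fun ω => √(N : ℝ) * (sampleMedian (fun i => Y (l, i) ω) - Real.log (Real.log 2)))
      (medianLaw γ N) μ := by
  have h : HasLaw (fun x : Fin N → ℝ => √(N : ℝ) * (sampleMedian x - Real.log (Real.log 2)))
      (medianLaw γ N) (Measure.pi fun _ : Fin N => γ) :=
    { aemeasurable := (measurable_medianLaw_aux N).aemeasurable, map_eq := rfl }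
  exact h.comp (hasLaw_block hY hind l)

variable [IsProbabilityMeasure γ]

lemma memLp_sampleMedian_block (hγ : ∀ x, γ.real (Set.Iic x) = 1 - Real.exp (-Real.exp x))
    {m N : ℕ} {Y : Fin m × Fin N → Ω → ℝ} (hY : ∀ p, HasLaw (Y p) γ μ) (hind : iIndepFun Y μ)
    (l : Fin m) : MemLp (fun ω => sampleMedian fun i => Y (l, i) ω) 2 μ := by
  have h1 : ∀ i, MemLp (fun ω => |Y (l, i) ω|) 2 μ := by
    intro i
    have h := memLp_two_of_cdf hγ
    rw [← (hY (l, i)).map_eq] at h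
    exact ((memLp_map_measure_iff h.aestronglyMeasurable (hY (l, i)).aemeasurable).1 h).abs
  refine (memLp_finsetSum Finset.univ fun i _ => h1 i).mono
    (hasLaw_sampleMedian_block hY hind l).aemeasurable.aestronglyMeasurable ?_
  refine Eventually.of_forall fun ω => ?_
  rw [Real.norm_eq_abs, Real.norm_eq_abs]
  exact (abs_sampleMedian_le _).trans (le_abs_self _)

variable [IsProbabilityMeasure μ]

/-- Sample medians of blocks have a common mean, so contrasts of them are centred. -/
lemma integral_contrast_sampleMedian_block
    (hγ : ∀ x, γ.real (Set.Iic x) = 1 - Real.exp (-Real.exp x))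
    {m N : ℕ} {Y : Fin m × Fin N → Ω → ℝ} (hY : ∀ p, HasLaw (Y p) γ μ) (hind : iIndepFun Y μ)
    {b : Fin m → ℝ} (hb : ∑ l, b l = 0) :
    ∫ ω, ∑ l, b l * sampleMedian (fun i => Y (l, i) ω) ∂μ = 0 := by
  rw [integral_finsetSum _ fun l _ =>
    ((memLp_sampleMedian_block hγ hY hind l).integrable one_le_two).const_mul (b l)]
  simp_rw [integral_const_mul, (hasLaw_sampleMedian_block hY hind _).integral_eq]
  rw [← Finset.sum_mul, hb, zero_mul]

lemma variance_sum_sampleMedian_block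
    (hγ : ∀ x, γ.real (Set.Iic x) = 1 - Real.exp (-Real.exp x))
    {m N : ℕ} {Y : Fin m × Fin N → Ω → ℝ} (hY : ∀ p, HasLaw (Y p) γ μ) (hind : iIndepFun Y μ)
    (b : Fin m → ℝ) :
    variance (fun ω => ∑ l, b l * sampleMedian (fun i => Y (l, i) ω)) μ =
      ∑ l, b l ^ 2 * variance (fun ω => sampleMedian fun i => Y (l, i) ω) μ := by
  have hi := (iIndepFun_sampleMedian_block (fun p => (hY p).aemeasurable) hind).comp
    (fun l x => b l * x) fun l => by fun_prop
  have h := IndepFun.variance_sum (μ := μ) (s := Finset.univ)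
    (X := fun l ω => b l * sampleMedian (fun i => Y (l, i) ω))
    (fun l _ => (memLp_sampleMedian_block hγ hY hind l).const_mul (b l))
    (fun l _ l' _ hll => hi.indepFun hll)
  rw [Finset.sum_fn] at h
  rw [h]
  exact Finset.sum_congr rfl fun l _ => variance_const_mul _ _ _

variable {m : ℕ} {Y : (N : ℕ) → Fin m × Fin N → Ω → ℝ}

lemma tendsto_mul_variance_sampleMedian_block
    (hγ : ∀ x, γ.real (Set.Iic x) = 1 - Real.exp (-Real.exp x))
    (hY : ∀ N p, HasLaw (Y N p) γ μ) (hind : ∀ N, iIndepFun (Y N) μ) (l : Fin m) :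
    Tendsto (fun N : ℕ => (N : ℝ) * variance (fun ω => sampleMedian fun i => Y N (l, i) ω) μ)
      atTop (𝓝 (1 / Real.log 2 ^ 2)) := by
  have hlim := (tendsto_integral_sq_medianLaw hγ).sub ((tendsto_integral_id_medianLaw hγ).pow 2)
  rw [zero_pow two_ne_zero, sub_zero] at hlim
  refine hlim.congr fun N => ?_
  have hM := memLp_sampleMedian_block hγ (hY N) (hind N) l
  have hZ := hasLaw_rescaled_sampleMedian_block (hY N) (hind N) l
  have hZL : MemLp (fun ω => √(N : ℝ) *
      (sampleMedian (fun i => Y N (l, i) ω) - Real.log (Real.log 2))) 2 μ :=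
    (hM.sub (memLp_const _)).const_mul _
  have h1 : variance (fun ω => √(N : ℝ) *
      (sampleMedian (fun i => Y N (l, i) ω) - Real.log (Real.log 2))) μ =
      N * variance (fun ω => sampleMedian fun i => Y N (l, i) ω) μ := by
    rw [variance_const_mul, Real.sq_sqrt (Nat.cast_nonneg N),
      variance_sub_const hM.aestronglyMeasurable]
  rw [← h1, variance_eq_sub hZL]
  congr 1
  · have := hZ.integral_comp (f := fun z : ℝ => z ^ 2) (by fun_prop)
    exact this.symm
  · rw [hZ.integral_eq]

lemma tendsto_mul_variance_sum_sampleMedian_block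
    (hγ : ∀ x, γ.real (Set.Iic x) = 1 - Real.exp (-Real.exp x))
    (hY : ∀ N p, HasLaw (Y N p) γ μ) (hind : ∀ N, iIndepFun (Y N) μ) (b : Fin m → ℝ) :
    Tendsto (fun N : ℕ => (N : ℝ) *
        variance (fun ω => ∑ l, b l * sampleMedian (fun i => Y N (l, i) ω)) μ)
      atTop (𝓝 ((∑ l, b l ^ 2) / Real.log 2 ^ 2)) := by
  have h := tendsto_finsetSum Finset.univ fun l _ =>
    (tendsto_mul_variance_sampleMedian_block hγ hY hind l).const_mul (b l ^ 2)
  rw [← Finset.sum_mul, mul_one_div] at h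
  refine h.congr fun N => ?_
  rw [variance_sum_sampleMedian_block hγ (hY N) (hind N), Finset.mul_sum]
  exact Finset.sum_congr rfl fun l _ => by ring

/-- A contrast does not see the common centre `log (log 2)`, so it may be rewritten in terms of
the rescaled medians, whose characteristic functions converge. -/
lemma tendstoInDistribution_contrast_sampleMedian_block
    (hγ : ∀ x, γ.real (Set.Iic x) = 1 - Real.exp (-Real.exp x))
    (hY : ∀ N p, HasLaw (Y N p) γ μ) (hind : ∀ N, iIndepFun (Y N) μ)
    {b : Fin m → ℝ} (hb : ∑ l, b l = 0) :
    TendstoInDistribution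
      (fun (N : ℕ) ω => √(N : ℝ) * ∑ l, b l * sampleMedian (fun i => Y N (l, i) ω)) atTop
      (id : ℝ → ℝ) (fun _ => μ)
      (gaussianReal 0 ((∑ l, b l ^ 2) / Real.log 2 ^ 2).toNNReal) := by
  set Z : (N : ℕ) → Fin m → Ω → ℝ := fun N l ω =>
    √(N : ℝ) * (sampleMedian (fun i => Y N (l, i) ω) - Real.log (Real.log 2)) with hZdef
  have hZ : ∀ N l, HasLaw (Z N l) (medianLaw γ N) μ := fun N l =>
    hasLaw_rescaled_sampleMedian_block (hY N) (hind N) l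
  have hsum : ∀ N : ℕ, (fun ω => √(N : ℝ) * ∑ l, b l * sampleMedian (fun i => Y N (l, i) ω)) =
      fun ω => ∑ l, b l * Z N l ω := by
    intro N
    funext ω
    have h0 : ∑ l, b l * Z N l ω = √(N : ℝ) * ∑ l, b l * sampleMedian (fun i => Y N (l, i) ω)
        - √(N : ℝ) * Real.log (Real.log 2) * ∑ l, b l := by
      rw [Finset.mul_sum, Finset.mul_sum, ← Finset.sum_sub_distrib]
      exact Finset.sum_congr rfl fun l _ => by simp only [hZdef]; ring
    rw [h0, hb, mul_zero, sub_zero]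
  have hmZ : ∀ N l, AEMeasurable (fun ω => b l * Z N l ω) μ := fun N l =>
    (hZ N l).aemeasurable.const_mul _
  have hindZ : ∀ N, iIndepFun (fun l ω => b l * Z N l ω) μ := fun N =>
    (iIndepFun_sampleMedian_block (fun p => (hY N p).aemeasurable) (hind N)).comp
      (fun l x => b l * (√(N : ℝ) * (x - Real.log (Real.log 2)))) fun l => by fun_prop
  rw [funext hsum]
  refine ⟨fun N => Finset.aemeasurable_fun_sum _ fun l _ => hmZ N l, aemeasurable_id, ?_⟩
  refine ProbabilityMeasure.tendsto_iff_tendsto_charFun.2 fun u => ?_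
  change Tendsto (fun N => charFun (μ.map fun ω => ∑ l, b l * Z N l ω) u) atTop
    (𝓝 (charFun ((gaussianReal 0 ((∑ l, b l ^ 2) / Real.log 2 ^ 2).toNNReal).map id) u))
  rw [Measure.map_id]
  have hlim : Tendsto (fun N => ∏ l, charFun (medianLaw γ N) (b l * u)) atTop
      (𝓝 (∏ l, charFun medianLimit (b l * u))) :=
    tendsto_finsetProd _ fun l _ => tendsto_charFun_medianLaw hγ _
  have hlimit : ∏ l, charFun medianLimit (b l * u) =
      charFun (gaussianReal 0 ((∑ l, b l ^ 2) / Real.log 2 ^ 2).toNNReal) u := by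
    have hL : (0 : ℝ) ≤ 1 / Real.log 2 ^ 2 := by positivity
    have hs : 0 ≤ (∑ l, b l ^ 2) / Real.log 2 ^ 2 := by positivity
    simp only [medianLimit, charFun_gaussianReal, Real.coe_toNNReal _ hL, Real.coe_toNNReal _ hs]
    rw [← Complex.exp_sum]
    congr 1
    push_cast
    simp only [mul_zero, zero_mul, zero_sub, Finset.sum_neg_distrib, neg_inj]
    rw [Finset.sum_div, Finset.sum_mul, Finset.sum_div]
    exact Finset.sum_congr rfl fun l _ => by ring
  rw [← hlimit]
  refine hlim.congr fun N => ?_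
  rw [(hindZ N).charFun_map_fun_sum_eq_prod (hmZ N), Finset.prod_apply]
  refine Finset.prod_congr rfl fun l _ => ?_
  rw [charFun_map_mul_comp (hZ N l).aemeasurable, (hZ N l).map_eq]

end Blocks

/-! ### Least squares on equally spaced levels -/

section LeastSquares

/-- The weights with which the responses enter the least squares slope for the design `x`. -/
noncomputable def olsWeight {m : ℕ} (x : Fin m → ℝ) (l : Fin m) : ℝ :=
  (x l - (∑ i, x i) / m) / ∑ i, (x i - (∑ l, x l) / m) ^ 2

variable {m : ℕ}

lemma sum_sub_mean (x : Fin m → ℝ) : ∑ i, (x i - (∑ l, x l) / m) = 0 := by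
  rcases Nat.eq_zero_or_pos m with rfl | hm
  · simp
  · have : (m : ℝ) ≠ 0 := by positivity
    rw [Finset.sum_sub_distrib, Finset.sum_const, Finset.card_univ, Fintype.card_fin, nsmul_eq_mul]
    field_simp
    ring

lemma olsSlope_eq_sum (x y : Fin m → ℝ) : olsSlope x y = ∑ l, olsWeight x l * y l := by
  have h : ∑ i, (x i - (∑ l, x l) / m) * (y i - (∑ l, y l) / m) =
      ∑ i, (x i - (∑ l, x l) / m) * y i := by
    simp_rw [mul_sub]
    rw [Finset.sum_sub_distrib, ← Finset.sum_mul, sum_sub_mean, zero_mul, sub_zero]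
  rw [olsSlope, h, Finset.sum_div]
  exact Finset.sum_congr rfl fun l _ => by rw [olsWeight]; ring

lemma sum_olsWeight (x : Fin m → ℝ) : ∑ l, olsWeight x l = 0 := by
  simp only [olsWeight]
  rw [← Finset.sum_div, sum_sub_mean, zero_div]

lemma sum_olsWeight_mul_self {x : Fin m → ℝ} (hx : ∑ i, (x i - (∑ l, x l) / m) ^ 2 ≠ 0) :
    ∑ l, olsWeight x l * x l = 1 := by
  have h : ∑ i, (x i - (∑ l, x l) / m) ^ 2 = ∑ i, (x i - (∑ l, x l) / m) * x i := by
    simp_rw [sq]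
    conv_lhs => enter [2, i]; rw [mul_sub]
    rw [Finset.sum_sub_distrib, ← Finset.sum_mul, sum_sub_mean, zero_mul, sub_zero]
  simp only [olsWeight]
  simp_rw [div_mul_eq_mul_div]
  rw [← Finset.sum_div, ← h, div_self hx]

lemma sum_sq_olsWeight (x : Fin m → ℝ) :
    ∑ l, olsWeight x l ^ 2 = (∑ i, (x i - (∑ l, x l) / m) ^ 2)⁻¹ := by
  simp only [olsWeight, div_pow]
  rw [← Finset.sum_div]
  set S := ∑ i, (x i - (∑ l, x l) / m) ^ 2
  rw [sq S, div_self_mul_self']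

lemma sum_sq_dev_consecutive (j₀ : ℤ) (hm : 0 < m) :
    ∑ i : Fin m, (((j₀ + (i : ℤ) : ℤ) : ℝ) - (∑ l : Fin m, ((j₀ + (l : ℤ) : ℤ) : ℝ)) / m) ^ 2 =
      m * ((m : ℝ) ^ 2 - 1) / 12 := by
  have h1 : ∀ n : ℕ, ∑ i ∈ Finset.range n, (i : ℝ) = n * (n - 1) / 2 := by
    intro n
    induction n with
    | zero => simp
    | succ n ih => rw [Finset.sum_range_succ, ih]; push_cast; ring
  have h2 : ∀ (n : ℕ) (c : ℝ), ∑ i ∈ Finset.range n, ((i : ℝ) - c) ^ 2 =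
      n * (n - 1) * (2 * n - 1) / 6 - c * (n * (n - 1)) + n * c ^ 2 := by
    intro n c
    induction n with
    | zero => simp
    | succ n ih => rw [Finset.sum_range_succ, ih]; push_cast; ring
  have hm0 : (m : ℝ) ≠ 0 := by positivity
  have hmean : (∑ l : Fin m, ((j₀ + (l : ℤ) : ℤ) : ℝ)) / m = j₀ + (m - 1) / 2 := by
    push_cast
    rw [Finset.sum_add_distrib, Fin.sum_univ_eq_sum_range (fun i => (i : ℝ)), h1]
    simp only [Finset.sum_const, Finset.card_univ, Fintype.card_fin, nsmul_eq_mul]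
    field_simp
  rw [hmean]
  have h3 : ∀ i : Fin m, (((j₀ + (i : ℤ) : ℤ) : ℝ) - (j₀ + (m - 1) / 2)) ^ 2 =
      ((i : ℕ) - ((m : ℝ) - 1) / 2) ^ 2 := fun i => by push_cast; ring
  simp_rw [h3]
  rw [Fin.sum_univ_eq_sum_range (fun i => ((i : ℝ) - ((m : ℝ) - 1) / 2) ^ 2), h2]
  ring

end LeastSquares

/-! ### The MEDLA estimator as a contrast of sample medians -/

section Estimator

variable {Ω : Type*}

/-- If the level-wise medians have centres that are affine in the level with slope
`-(2 * H + 1) * log 2`, then the regression slope estimates it with error a contrast of the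
centred medians. -/
lemma medlaSlope_eq {B : ℝ → Ω → ℝ} {ψ : ℝ → ℝ} {j₀ : ℤ} {m N : ℕ} (hm : 2 ≤ m)
    {K : Fin m → Fin N → Fin 2 → Ω → ℤ} {ω : Ω} {M : Fin m → ℝ} {H c : ℝ}
    (hM : ∀ l : Fin m, medlaMedian B ψ (j₀ + (l : ℤ)) (K l) ω =
      M l + (-((j₀ + (l : ℤ) : ℤ) : ℝ) * (2 * H + 1) * Real.log 2 + c)) :
    medlaSlope B ψ j₀ K ω =
      (∑ l, olsWeight (fun l : Fin m => ((j₀ + (l : ℤ) : ℤ) : ℝ)) l * M l) -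
        (2 * H + 1) * Real.log 2 := by
  have hS : ∑ i : Fin m, (((j₀ + (i : ℤ) : ℤ) : ℝ) -
      (∑ l : Fin m, ((j₀ + (l : ℤ) : ℤ) : ℝ)) / m) ^ 2 ≠ 0 := by
    rw [sum_sq_dev_consecutive j₀ (by omega)]
    have : (2 : ℝ) ≤ m := by exact_mod_cast hm
    have h1 : 0 < (m : ℝ) ^ 2 - 1 := by nlinarith
    positivity
  have h1 := sum_olsWeight_mul_self hS
  have h0 := sum_olsWeight fun l : Fin m => ((j₀ + (l : ℤ) : ℤ) : ℝ)
  rw [medlaSlope, olsSlope_eq_sum]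
  simp_rw [hM]
  set w := olsWeight fun l : Fin m => ((j₀ + (l : ℤ) : ℤ) : ℝ)
  have h2 : ∀ l : Fin m, w l * (M l + (-((j₀ + (l : ℤ) : ℤ) : ℝ) * (2 * H + 1) * Real.log 2 + c)) =
      w l * M l - (2 * H + 1) * Real.log 2 * (w l * ((j₀ + (l : ℤ) : ℤ) : ℝ)) + c * w l :=
    fun l => by ring
  simp_rw [h2]
  rw [Finset.sum_add_distrib, Finset.sum_sub_distrib, ← Finset.mul_sum, ← Finset.mul_sum, h1, h0]
  ring

lemma medlaEstimator_eq {B : ℝ → Ω → ℝ} {ψ : ℝ → ℝ} {j₀ : ℤ} {m N : ℕ} (hm : 2 ≤ m)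
    {K : Fin m → Fin N → Fin 2 → Ω → ℤ} {ω : Ω} {M : Fin m → ℝ} {H c : ℝ}
    (hM : ∀ l : Fin m, medlaMedian B ψ (j₀ + (l : ℤ)) (K l) ω =
      M l + (-((j₀ + (l : ℤ) : ℤ) : ℝ) * (2 * H + 1) * Real.log 2 + c)) :
    medlaEstimator B ψ j₀ K ω =
      H + ∑ l, -olsWeight (fun l : Fin m => ((j₀ + (l : ℤ) : ℤ) : ℝ)) l /
        (2 * Real.log 2) * M l := by
  have hL : Real.log 2 ≠ 0 := (Real.log_pos one_lt_two).ne'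
  have h : ∀ l : Fin m, -olsWeight (fun l : Fin m => ((j₀ + (l : ℤ) : ℤ) : ℝ)) l /
      (2 * Real.log 2) * M l = -(1 / (2 * Real.log 2)) *
        (olsWeight (fun l : Fin m => ((j₀ + (l : ℤ) : ℤ) : ℝ)) l * M l) := fun l => by ring
  rw [medlaEstimator, medlaSlope_eq hm hM, Finset.sum_congr rfl fun l _ => h l, ← Finset.mul_sum]
  field_simp
  ring

variable [MeasurableSpace Ω] {μ : Measure Ω}

/-- Recentring by the logarithm of the variance turns the log-averaged energy of an independent
Gaussian pair into a variable whose law does not depend on the variance. -/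
lemma hasLaw_logMeanEnergy_sub {v : NNReal} (hv : v ≠ 0) {P : Ω → ℝ × ℝ}
    (hP : HasLaw P ((gaussianReal 0 v).prod (gaussianReal 0 v)) μ) :
    HasLaw (fun ω => logMeanEnergy (P ω) - Real.log v) logEnergyLaw μ := by
  have h : HasLaw (fun d : ℝ × ℝ => logMeanEnergy d - Real.log v) logEnergyLaw
      ((gaussianReal 0 v).prod (gaussianReal 0 v)) :=
    { aemeasurable := (measurable_logMeanEnergy.sub_const _).aemeasurable
      map_eq := map_logMeanEnergy_sub_eq hv }
  exact h.comp hP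

end Estimator

theorem mainTheorem4 {Ω : Type*} [MeasurableSpace Ω] (μ : Measure Ω) [IsProbabilityMeasure μ]
    -- the signal: a fractional Brownian motion
    (H : ℝ) (hH : H ∈ Set.Ioo (0 : ℝ) 1)
    (B : ℝ → Ω → ℝ) (hB : IsFractionalBrownianMotion H B μ)
    -- the wavelet, with a nondegenerate coefficient at level 0
    (ψ : ℝ → ℝ) (hψ : Integrable ψ) (hψH : Integrable fun t : ℝ => |t| ^ H * ψ t)
    (hψ0 : ∫ t, ψ t = 0)
    (hσ : 0 < variance (waveletCoeff B ψ 0 0) μ)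
    -- the levels of the spectrum: j₀, …, j₀ + m - 1
    (j₀ : ℤ) (m : ℕ) (hm : 2 ≤ m)
    -- coefficients of one level that are more than `q j` apart are independent
    (q : ℤ → ℝ)
    (hq : ∀ (l : Fin m) (k₁ k₂ : ℤ), q (j₀ + (l : ℤ)) < |(k₁ : ℝ) - (k₂ : ℝ)| →
      IndepFun (waveletCoeff B ψ (j₀ + (l : ℤ)) k₁) (waveletCoeff B ψ (j₀ + (l : ℤ)) k₂) μ)
    -- for every sample size N: the random positions of N pairs on each level
    (K : (N : ℕ) → Fin m → Fin N → Fin 2 → Ω → ℤ)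
    (hK : ∀ N l i e, Measurable (K N l i e))
    (hKq : ∀ N (l : Fin m) i, ∀ᵐ ω ∂μ,
      q (j₀ + (l : ℤ)) < |(K N l i 0 ω : ℝ) - (K N l i 1 ω : ℝ)|)
    (hKB : ∀ N l i, IndepFun (fun ω (e : Fin 2) => K N l i e ω)
      (fun ω (p : ℤ × ℤ) => waveletCoeff B ψ p.1 p.2 ω) μ)
    -- the sampled pairs of coefficients are independent, within and across the levels
    (hind : ∀ N, iIndepFun
      (fun (p : Fin m × Fin N) ω => sampledPair B ψ (j₀ + (p.1 : ℤ)) (K N p.1 p.2) ω) μ) :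
    -- level-wise sample medians
    (∀ l : Fin m, Tendsto
      (fun N : ℕ => (N : ℝ) * variance (medlaMedian B ψ (j₀ + (l : ℤ)) (K N l)) μ) atTop
      (𝓝 (1 / Real.log 2 ^ 2))) ∧
    -- OLS slope
    Tendsto (fun N : ℕ => (N : ℝ) * variance (medlaSlope B ψ j₀ (K N)) μ) atTop
      (𝓝 (12 / (m * ((m : ℝ) ^ 2 - 1) * Real.log 2 ^ 2))) ∧
    -- mean and variance of the estimator
    (∀ N : ℕ, 0 < N → MemLp (medlaEstimator B ψ j₀ (K N)) 2 μ ∧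
      ∫ ω, medlaEstimator B ψ j₀ (K N) ω ∂μ = H) ∧
    Tendsto (fun N : ℕ => (N : ℝ) * variance (medlaEstimator B ψ j₀ (K N)) μ) atTop
      (𝓝 (3 / (m * ((m : ℝ) ^ 2 - 1) * Real.log 2 ^ 4))) ∧
    -- asymptotic normality of the estimator
    TendstoInDistribution
      (fun (N : ℕ) ω => √(N : ℝ) * (medlaEstimator B ψ j₀ (K N) ω - H)) atTop
      (id : ℝ → ℝ) (fun _ => μ)
      (gaussianReal 0 (3 / (m * ((m : ℝ) ^ 2 - 1) * Real.log 2 ^ 4)).toNNReal) := by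
  have hL : 0 < Real.log 2 := Real.log_pos one_lt_two
  have hm2 : (2 : ℝ) ≤ m := by exact_mod_cast hm
  have hm1 : 0 < (m : ℝ) ^ 2 - 1 := by nlinarith
  set σ2 := variance (waveletCoeff B ψ 0 0) μ with hσ2
  set v : Fin m → NNReal := fun l =>
    ((2 : ℝ) ^ (-((j₀ + (l : ℤ) : ℤ) : ℝ) * (2 * H + 1)) * σ2).toNNReal with hv_def
  have hv0 : ∀ l, 0 < (2 : ℝ) ^ (-((j₀ + (l : ℤ) : ℤ) : ℝ) * (2 * H + 1)) * σ2 := fun l =>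
    mul_pos (Real.rpow_pos_of_pos two_pos _) hσ
  have hv : ∀ l, v l ≠ 0 := fun l => (Real.toNNReal_pos.2 (hv0 l)).ne'
  have hlog : ∀ l : Fin m, Real.log (v l) =
      -((j₀ + (l : ℤ) : ℤ) : ℝ) * (2 * H + 1) * Real.log 2 + Real.log σ2 := fun l => by
    rw [hv_def, Real.coe_toNNReal _ (hv0 l).le,
      Real.log_mul (Real.rpow_pos_of_pos two_pos _).ne' hσ.ne', Real.log_rpow two_pos]
  -- the recentred log-averaged energies are independent copies of one variable
  set Y : (N : ℕ) → Fin m × Fin N → Ω → ℝ := fun N p ω =>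
    logMeanEnergy (sampledPair B ψ (j₀ + (p.1 : ℤ)) (K N p.1 p.2) ω) - Real.log (v p.1) with hY_def
  have hY : ∀ N p, HasLaw (Y N p) logEnergyLaw μ := fun N p =>
    hasLaw_logMeanEnergy_sub (hv p.1) <|
      hasLaw_sampledPair (fun k => hasLaw_waveletCoeff hB hH.1 hψ hψH hψ0 _ k)
        (hq p.1) (hK N p.1 p.2) (hKq N p.1 p.2) (hKB N p.1 p.2)
  have hYind : ∀ N, iIndepFun (Y N) μ := fun N =>
    (hind N).comp (fun p d => logMeanEnergy d - Real.log (v p.1))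
      fun p => measurable_logMeanEnergy.sub_const _
  have hγ := logEnergyLaw_real_Iic
  have hmed : ∀ {N : ℕ}, 0 < N → ∀ (ω : Ω) (l : Fin m),
      medlaMedian B ψ (j₀ + (l : ℤ)) (K N l) ω = sampleMedian (fun i => Y N (l, i) ω) +
        (-((j₀ + (l : ℤ) : ℤ) : ℝ) * (2 * H + 1) * Real.log 2 + Real.log σ2) := by
    intro N hN ω l
    rw [← hlog, ← sampleMedian_add_const hN]
    simp only [hY_def, sub_add_cancel]
    rfl
  set w := olsWeight fun l : Fin m => ((j₀ + (l : ℤ) : ℤ) : ℝ) with hw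
  have hw0 : ∑ l, w l = 0 := sum_olsWeight _
  have hw2 : ∑ l, w l ^ 2 = 12 / (m * ((m : ℝ) ^ 2 - 1)) := by
    rw [hw, sum_sq_olsWeight, sum_sq_dev_consecutive j₀ (by omega), inv_div]
  have hslope : ∀ {N : ℕ}, 0 < N → ∀ ω, medlaSlope B ψ j₀ (K N) ω =
      (∑ l, w l * sampleMedian (fun i => Y N (l, i) ω)) - (2 * H + 1) * Real.log 2 :=
    fun hN ω => medlaSlope_eq hm (hmed hN ω)
  set b : Fin m → ℝ := fun l => -w l / (2 * Real.log 2) with hb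
  have hb0 : ∑ l, b l = 0 := by
    rw [hb, ← Finset.sum_div, Finset.sum_neg_distrib, hw0, neg_zero, zero_div]
  have hb2 : (∑ l, b l ^ 2) / Real.log 2 ^ 2 = 3 / (m * ((m : ℝ) ^ 2 - 1) * Real.log 2 ^ 4) := by
    have h : ∀ l, b l ^ 2 = w l ^ 2 / (2 * Real.log 2) ^ 2 := fun l => by
      rw [hb, div_pow, neg_sq]
    simp_rw [h]
    rw [← Finset.sum_div, hw2]
    field_simp
    norm_num
  have hest : ∀ {N : ℕ}, 0 < N → ∀ ω, medlaEstimator B ψ j₀ (K N) ω =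
      H + ∑ l, b l * sampleMedian (fun i => Y N (l, i) ω) :=
    fun hN ω => medlaEstimator_eq hm (hmed hN ω)
  have hM := fun N l => memLp_sampleMedian_block hγ (hY N) (hYind N) l
  have hMsum : ∀ (N : ℕ) (a : Fin m → ℝ),
      MemLp (fun ω => ∑ l, a l * sampleMedian (fun i => Y N (l, i) ω)) 2 μ := fun N a =>
    memLp_finsetSum _ fun l _ => (hM N l).const_mul (a l)
  refine ⟨fun l => ?_, ?_, fun N hN => ?_, ?_, ?_⟩
  · refine (tendsto_mul_variance_sampleMedian_block hγ hY hYind l).congr' ?_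
    filter_upwards [eventually_gt_atTop 0] with N hN
    rw [funext fun ω => hmed hN ω l, variance_add_const (hM N l).aestronglyMeasurable]
  · have h := tendsto_mul_variance_sum_sampleMedian_block hγ hY hYind w
    rw [hw2, div_div] at h
    refine h.congr' ?_
    filter_upwards [eventually_gt_atTop 0] with N hN
    rw [funext (hslope hN), variance_sub_const (hMsum N w).aestronglyMeasurable]
  · rw [funext (hest hN)]
    refine ⟨(memLp_const H).add (hMsum N b), ?_⟩
    rw [integral_add (integrable_const H) ((hMsum N b).integrable one_le_two),
      integral_contrast_sampleMedian_block hγ (hY N) (hYind N) hb0]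
    simp
  · have h := tendsto_mul_variance_sum_sampleMedian_block hγ hY hYind b
    rw [hb2] at h
    refine h.congr' ?_
    filter_upwards [eventually_gt_atTop 0] with N hN
    rw [funext (hest hN), variance_const_add (hMsum N b).aestronglyMeasurable]
  · have h := tendstoInDistribution_contrast_sampleMedian_block hγ hY hYind hb0
    rw [hb2] at h
    convert h using 3 with N ω
    -- for the empty sample both sides vanish because of the factor `√N`
    rcases Nat.eq_zero_or_pos N with rfl | hN
    · simp
    · rw [hest hN, add_sub_cancel_left]
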